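/- **Setting.** Let $(P_t)_{t\ge 0}$ be a Markov semigroup on a measurable space $E$, given by Markov kernels $P_t(x,dy)$ with $P_0=\mathrm{Id}$, $P_{s+t}=P_sP_t$, and $P_tf(x)=\int f(y)\,P_t(x,dy)$. Let $L f=\partial_t P_t f|_{t=0}$ be its generator; $f$ is in its domain if $(P_tf-f)/t$ converges pointwise and boundedly as $t\to0^+$. Suppose that $(P_t)$ is a *diffusion semigroup*: there is a unital algebra $\mathcal A$ of bounded measurable real functions on $E$, contained in the domain of $L$ and stable under each $P_t$, under $L$ and under composition with functions $\phi\in C^\infty(\mathbb R)$, such that for all $f\in\mathcal A$ and $\phi\in C^\infty(\mathbb R)$ $$L\phi(f)=\phi'(f)\,Lf+\phi''(f)\,\Gamma(f),\qquad\text{where } \Gamma(f,g)=\tfrac12\big(L(fg)-f\,Lg-g\,Lf\big),\quad \Gamma(f)=\Gamma(f,f).$$ Put $\Gamma_2(f)=\tfrac12\big(L\Gamma(f)-2\Gamma(f,Lf)\big)$. For $\rho\in\mathbb R$, the semigroup satisfies $CD(\rho,\infty)$ if $\Gamma_2(f)\ge\rho\,\Gamma(f)$ on $E$ for all $f\in\mathcal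 A$. For $f\in\mathcal A$ and $t>0$ let $Q_tf$ be the vanishing viscosity solution at time $t$ of the Hamilton–Jacobi equation $\partial_t v+\frac12\Gamma(v)=0$, $v_0=f$, i.e. $$Q_tf=\liminf_{\varepsilon\to0^+}v^\varepsilon_t,\qquad v^\varepsilon_t=-2\varepsilon\log P_{\varepsilon t}\big(e^{-f/(2\varepsilon)}\big),$$ where $v^\varepsilon$ solves $\partial_t v^\varepsilon+\frac12\Gamma(v^\varepsilon)-\varepsilon L v^\varepsilon=0$, $v^\varepsilon_0=f$ (the lower limit is the limit whenever the limit exists). **Theorem.** Let $\rho\in\mathbb R$ and let $(P_t)_{t\ge0}$ be a diffusion Markov semigroup. The following are equivalent: (i) $(P_t)_{t\ge0}$ satisfies the $CD(\rho,\infty)$ criterion; (ii) for all $q_1>q_2>0$ and $u,t>0$ such that $$q_1=q_2+\frac{\rho t}{1-e^{-2\rho u}}$$ (to be read as $q_1=q_2+\frac{t}{2u}$ when $\rho=0$), one has, everywhere on $E$ and for all $f\in\mathcal A$, $$P_u\big(e^{q_1Q_tf}\big)^{1/q_1}\le P_u\big(e^{q_2f}\big)^{1/q_2}.$$ -/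

import Mathlib

open MeasureTheory ProbabilityTheory Filter Topology Set
open scoped ContDiff

noncomputable section

/-- A Markov semigroup on a measurable space `E`: a family of Markov kernels indexed by the times
`t ≥ 0` (negative times carry no information), starting from the identity and satisfying the
Chapman-Kolmogorov (semigroup) property. -/
structure MarkovSemigroup (E : Type*) [MeasurableSpace E] where
  /-- the transition kernels `P_t(x, dy)` -/
  kernel : ℝ → Kernel E E
  isMarkov : ∀ t, 0 ≤ t → IsMarkovKernel (kernel t)
  kernel_zero : kernel 0 = Kernel.id
  kernel_add : ∀ s t, 0 ≤ s → 0 ≤ t → kernel (s + t) = kernel t ∘ₖ kernel s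

namespace MarkovSemigroup

variable {E : Type*} [MeasurableSpace E] (P : MarkovSemigroup E)

/-- The operator `P_t`: `P_t f (x) = ∫ f(y) P_t(x, dy)`. -/
def op (t : ℝ) (f : E → ℝ) (x : E) : ℝ := ∫ y, f y ∂(P.kernel t x)

/-- The infinitesimal generator `L f = ∂_t P_t f` at `t = 0` (right derivative). -/
def gen (f : E → ℝ) (x : E) : ℝ := derivWithin (fun t => P.op t f x) (Ici 0) 0

/-- `f` belongs to the domain of the generator: `(P_t f - f) / t` converges pointwise and
boundedly as `t → 0+`. -/
def InDomain (f : E → ℝ) : Prop :=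
  (∀ x, DifferentiableWithinAt ℝ (fun t => P.op t f x) (Ici 0) 0) ∧
    ∃ C : ℝ, ∀ t, 0 ≤ t → ∀ x, |P.op t f x - f x| ≤ C * t

/-- The carré du champ `Γ(f, g) = (L(fg) - f Lg - g Lf) / 2`. -/
def carreDuChamp (f g : E → ℝ) (x : E) : ℝ :=
  (P.gen (fun y => f y * g y) x - f x * P.gen g x - g x * P.gen f x) / 2

/-- The iterated carré du champ `Γ₂(f) = (L Γ(f) - 2 Γ(f, Lf)) / 2`. -/
def gammaTwo (f : E → ℝ) (x : E) : ℝ :=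
  (P.gen (P.carreDuChamp f f) x - 2 * P.carreDuChamp f (P.gen f) x) / 2

/-- `P` is a diffusion semigroup with (nice) algebra `A`: a unital algebra of bounded measurable
functions in the domain of the generator `L`, stable under the semigroup, under `L` and under
composition with smooth functions, and on which `L` satisfies the diffusion property
`L φ(f) = φ'(f) L f + φ''(f) Γ(f)`. -/
structure IsDiffusion (A : Subalgebra ℝ (E → ℝ)) : Prop where
  measurable : ∀ f ∈ A, Measurable f
  bounded : ∀ f ∈ A, ∃ C : ℝ, ∀ x, |f x| ≤ C
  inDomain : ∀ f ∈ A, P.InDomain f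
  op_mem : ∀ t, 0 ≤ t → ∀ f ∈ A, P.op t f ∈ A
  gen_mem : ∀ f ∈ A, P.gen f ∈ A
  comp_mem : ∀ φ : ℝ → ℝ, ContDiff ℝ ∞ φ → ∀ f ∈ A, (fun x => φ (f x)) ∈ A
  chain_rule : ∀ φ : ℝ → ℝ, ContDiff ℝ ∞ φ → ∀ f ∈ A, ∀ x,
    P.gen (fun y => φ (f y)) x =
      deriv φ (f x) * P.gen f x + deriv (deriv φ) (f x) * P.carreDuChamp f f x

/-- The curvature-dimension criterion `CD(ρ, ∞)`: `Γ₂(f) ≥ ρ Γ(f)` for all `f` in `A`. -/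
def CDInfty (A : Subalgebra ℝ (E → ℝ)) (ρ : ℝ) : Prop :=
  ∀ f ∈ A, ∀ x, ρ * P.carreDuChamp f f x ≤ P.gammaTwo f x

/-- `v^ε_t = -2ε log P_{εt}(e^{-f/(2ε)})`, which solves the viscous Hamilton-Jacobi equation
`∂_t v + Γ(v)/2 - ε L v = 0` with initial value `f`. -/
def viscousHJ (ε t : ℝ) (f : E → ℝ) (x : E) : ℝ :=
  -2 * ε * Real.log (P.op (ε * t) (fun y => Real.exp (-f y / (2 * ε))) x)

/-- The Hamilton-Jacobi semigroup `Q_t f`: the vanishing viscosity solution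
`Q_t f = lim_{ε → 0+} v^ε_t` of `∂_t v + Γ(v)/2 = 0`, `v_0 = f`. The lower limit, which is the limit
whenever the latter exists, makes this meaningful for all bounded `f`. -/
def hamiltonJacobi (t : ℝ) (f : E → ℝ) (x : E) : ℝ :=
  liminf (fun ε => P.viscousHJ ε t f x) (𝓝[>] (0 : ℝ))

/-- A classical solution on `[0, T]` of `∂_t v + Γ(v)/2 = 0` with `v_0 = f`: a curve in `A`,
differentiable in the sup norm, and such that `L v_s` is bounded uniformly in `s`. -/
structure IsClassicalHJ (A : Subalgebra ℝ (E → ℝ)) (T : ℝ) (f : E → ℝ) (v : ℝ → E → ℝ) : Prop where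
  initial : v 0 = f
  mem : ∀ s ∈ Icc 0 T, v s ∈ A
  equation : ∀ s ∈ Icc 0 T, ∀ η > 0, ∀ᶠ r in 𝓝[Icc 0 T] s, ∀ x,
    |v r x - v s x - (r - s) * (-(P.carreDuChamp (v s) (v s) x) / 2)| ≤ η * |r - s|
  bounded_gen : ∃ C : ℝ, ∀ s ∈ Icc 0 T, ∀ x, |P.gen (v s) x| ≤ C

section Consistency

variable {P} {A : Subalgebra ℝ (E → ℝ)}

lemma IsDiffusion.integrable (h : P.IsDiffusion A) {f : E → ℝ} (hf : f ∈ A) {t : ℝ} (ht : 0 ≤ t)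
    (x : E) : Integrable f (P.kernel t x) := by
  obtain ⟨C, hC⟩ := h.bounded f hf
  have := P.isMarkov t ht
  exact Integrable.of_bound (h.measurable f hf).aestronglyMeasurable C (ae_of_all _ hC)

lemma op_zero {f : E → ℝ} (hf : Measurable f) (x : E) : P.op 0 f x = f x := by
  unfold op
  rw [P.kernel_zero, Kernel.id_apply, integral_dirac' _ _ hf.stronglyMeasurable]

lemma IsDiffusion.op_add (h : P.IsDiffusion A) {f : E → ℝ} (hf : f ∈ A) {s t : ℝ} (hs : 0 ≤ s)
    (ht : 0 ≤ t) (x : E) : P.op (s + t) f x = P.op s (P.op t f) x := by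
  have hi := h.integrable hf (add_nonneg hs ht) x
  unfold op
  rw [P.kernel_add s t hs ht] at hi ⊢
  exact Kernel.integral_comp hi

lemma IsDiffusion.op_sub (h : P.IsDiffusion A) {f g : E → ℝ} (hf : f ∈ A) (hg : g ∈ A) {t : ℝ}
    (ht : 0 ≤ t) (x : E) : P.op t (f - g) x = P.op t f x - P.op t g x :=
  integral_sub (h.integrable hf ht x) (h.integrable hg ht x)

lemma op_const_mul (c : ℝ) (f : E → ℝ) (t : ℝ) (x : E) :
    P.op t (fun y => c * f y) x = c * P.op t f x := integral_const_mul _ _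

lemma op_mono (h : P.IsDiffusion A) {f g : E → ℝ} (hf : f ∈ A) (hg : g ∈ A) {t : ℝ}
    (ht : 0 ≤ t) (hfg : ∀ x, f x ≤ g x) (x : E) : P.op t f x ≤ P.op t g x :=
  integral_mono (h.integrable hf ht x) (h.integrable hg ht x) hfg

lemma abs_op_le {f : E → ℝ} {C t : ℝ} (ht : 0 ≤ t) (hf : ∀ x, |f x| ≤ C) (x : E) :
    |P.op t f x| ≤ C := by
  have := P.isMarkov t ht
  simpa [op] using norm_integral_le_of_norm_le_const (μ := P.kernel t x) (f := f) (C := C)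
    (ae_of_all _ hf)

lemma IsDiffusion.lipschitz (h : P.IsDiffusion A) {f : E → ℝ} (hf : f ∈ A) :
    ∃ C : ℝ, ∀ s t, 0 ≤ s → 0 ≤ t → ∀ x, |P.op s f x - P.op t f x| ≤ C * |s - t| := by
  obtain ⟨C, hC⟩ := (h.inDomain f hf).2
  have key : ∀ s t, 0 ≤ t → t ≤ s → ∀ x, |P.op s f x - P.op t f x| ≤ C * |s - t| := by
    intro s t ht hst x
    have e : P.op s f x = P.op t (P.op (s - t) f) x := by
      rw [← h.op_add hf ht (sub_nonneg.2 hst)]; congr 1; ring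
    rw [e, ← h.op_sub (h.op_mem _ (sub_nonneg.2 hst) f hf) hf ht, abs_of_nonneg (sub_nonneg.2 hst)]
    exact abs_op_le ht (fun y => hC _ (sub_nonneg.2 hst) y) x
  refine ⟨C, fun s t hs ht x => ?_⟩
  rcases le_total t s with hst | hst
  · exact key s t ht hst x
  · rw [abs_sub_comm, abs_sub_comm s]; exact key t s hs hst x

lemma IsDiffusion.continuousOn (h : P.IsDiffusion A) {f : E → ℝ} (hf : f ∈ A) (x : E) :
    ContinuousOn (fun t => P.op t f x) (Ici 0) := by
  obtain ⟨C, hC⟩ := h.lipschitz hf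
  have : LipschitzOnWith C.toNNReal (fun t => P.op t f x) (Ici 0) := by
    refine LipschitzOnWith.of_dist_le_mul fun s hs t ht => ?_
    rw [Real.dist_eq, Real.dist_eq]
    exact (hC s t hs ht x).trans
      (mul_le_mul_of_nonneg_right (Real.le_coe_toNNReal C) (abs_nonneg _))
  exact this.continuousOn

lemma IsDiffusion.exp_mem (h : P.IsDiffusion A) {f : E → ℝ} (hf : f ∈ A) (a b : ℝ) :
    (fun x => Real.exp (a * f x + b)) ∈ A :=
  h.comp_mem (fun y => Real.exp (a * y + b)) (by fun_prop) f hf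

/-- Right derivative: `∂_t P_t f = P_t L f`. -/
lemma IsDiffusion.hasDerivWithinAt_right (h : P.IsDiffusion A) {f : E → ℝ} (hf : f ∈ A) {t : ℝ}
    (ht : 0 ≤ t) (x : E) :
    HasDerivWithinAt (fun s => P.op s f x) (P.op t (P.gen f) x) (Ici t) t := by
  have := P.isMarkov t ht
  obtain ⟨C, hC⟩ := (h.inDomain f hf).2
  rw [← hasDerivWithinAt_Ioi_iff_Ici, hasDerivWithinAt_iff_tendsto_slope' (by simp)]
  have hlim : ∀ y, Tendsto (fun s => (s - t)⁻¹ * (P.op (s - t) f y - f y)) (𝓝[>] t)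
      (𝓝 (P.gen f y)) := by
    intro y
    have h0 := ((h.inDomain f hf).1 y).hasDerivWithinAt
    rw [← hasDerivWithinAt_Ioi_iff_Ici, hasDerivWithinAt_iff_tendsto_slope' (by simp)] at h0
    have hm : Tendsto (fun s : ℝ => s - t) (𝓝[>] t) (𝓝[>] 0) := by
      refine tendsto_nhdsWithin_iff.2 ⟨?_, ?_⟩
      · have : Tendsto (fun s : ℝ => s - t) (𝓝 t) (𝓝 (t - t)) :=
          (continuous_id.sub continuous_const).tendsto t
        rw [sub_self] at this
        exact this.mono_left nhdsWithin_le_nhds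
      · filter_upwards [self_mem_nhdsWithin] with s hs
        exact sub_pos.2 (mem_Ioi.1 hs)
    have := h0.comp hm
    refine this.congr fun s => ?_
    simp [slope_def_field, op_zero (h.measurable f hf), div_eq_inv_mul]
  have hdc := tendsto_integral_filter_of_dominated_convergence (μ := P.kernel t x)
    (F := fun s y => (s - t)⁻¹ * (P.op (s - t) f y - f y)) (f := P.gen f) (l := 𝓝[>] t)
    (fun _ => C) ?_ ?_ (integrable_const _) (ae_of_all _ hlim)
  · refine hdc.congr' ?_
    filter_upwards [self_mem_nhdsWithin] with s hs
    have hs' : 0 ≤ s - t := (sub_pos.2 hs).le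
    have e : P.op s f x = P.op t (P.op (s - t) f) x := by
      rw [← h.op_add hf ht hs']; congr 1; ring
    rw [slope_def_field, e, ← h.op_sub (h.op_mem _ hs' f hf) hf ht, div_eq_inv_mul]
    exact integral_const_mul _ _
  · filter_upwards [self_mem_nhdsWithin] with s hs
    have hs' : 0 ≤ s - t := (sub_pos.2 hs).le
    exact (((h.measurable _ (h.op_mem _ hs' f hf)).sub (h.measurable f hf)).const_mul
      _).aestronglyMeasurable
  · filter_upwards [self_mem_nhdsWithin] with s hs
    have hs' : 0 < s - t := sub_pos.2 hs
    refine ae_of_all _ fun y => ?_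
    rw [Real.norm_eq_abs, abs_mul, abs_of_pos (inv_pos.2 hs'), inv_mul_le_iff₀ hs', mul_comm]
    exact hC _ hs'.le y

/-- The heat equation `∂_t P_t f = P_t L f` for `t ≥ 0`. -/
lemma IsDiffusion.hasDerivWithinAt_op (h : P.IsDiffusion A) {f : E → ℝ} (hf : f ∈ A) {t : ℝ}
    (ht : 0 ≤ t) (x : E) :
    HasDerivWithinAt (fun s => P.op s f x) (P.op t (P.gen f) x) (Ici 0) t := by
  have hg := h.gen_mem f hf
  -- the integrand, extended to all times
  set k : ℝ → ℝ := fun s => P.op (max s 0) (P.gen f) x with hk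
  have hkc : Continuous k := by
    rw [← continuousOn_univ]
    exact (h.continuousOn hg x).comp (by fun_prop) fun s _ => le_max_right s 0
  have hI : ∀ s, HasDerivAt (fun u => ∫ r in (0 : ℝ)..u, k r) (k s) s := fun s =>
    intervalIntegral.integral_hasDerivAt_right (hkc.intervalIntegrable _ _)
      (hkc.stronglyMeasurableAtFilter _ _) hkc.continuousAt
  have hconst : ∀ s, 0 ≤ s → P.op s f x - ∫ r in (0 : ℝ)..s, k r = P.op 0 f x := by
    intro s hs
    have := constant_of_has_deriv_right_zero (a := 0) (b := s)
      (f := fun s => P.op s f x - ∫ r in (0 : ℝ)..s, k r)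
      (((h.continuousOn hf x).mono Icc_subset_Ici_self).sub
        fun r _ => (hI r).continuousAt.continuousWithinAt) ?_ s ⟨hs, le_rfl⟩
    · simpa using this
    · intro r hr
      have := (h.hasDerivWithinAt_right hf hr.1 x).sub (hI r).hasDerivWithinAt
      have e : k r = P.op r (P.gen f) x := by simp [hk, max_eq_left hr.1]
      rw [e, sub_self] at this
      exact this
  have h1 : HasDerivWithinAt (fun s => P.op 0 f x + ∫ r in (0 : ℝ)..s, k r) (k t) (Ici 0) t :=
    ((hI t).const_add _).hasDerivWithinAt
  have h2 : k t = P.op t (P.gen f) x := by simp [hk, max_eq_left ht]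
  rw [← h2]
  exact h1.congr (fun s hs => by rw [← hconst s hs]; ring) (by rw [← hconst t ht]; ring)

lemma IsDiffusion.hasDerivWithinAt_flow (h : P.IsDiffusion A) {ε t s : ℝ} (hε : 0 ≤ ε)
    {g : ℝ → E → ℝ} (hg : ∀ r ∈ Icc 0 t, g r ∈ A) {D : E → ℝ} (hD : D ∈ A) (hs : s ∈ Icc 0 t)
    (hder : ∀ η > 0, ∀ᶠ r in 𝓝[Icc 0 t] s, ∀ y, |g r y - g s y - (r - s) * D y| ≤ η * |r - s|)
    (x : E) :
    HasDerivWithinAt (fun r => P.op (ε * (t - r)) (g r) x)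
      (P.op (ε * (t - s)) D x - ε * P.op (ε * (t - s)) (P.gen (g s)) x) (Icc 0 t) s := by
  have hmaps : MapsTo (fun r => ε * (t - r)) (Icc 0 t) (Ici 0) := fun r hr =>
    mul_nonneg hε (sub_nonneg.2 hr.2)
  have h1 : HasDerivWithinAt (fun r => P.op (ε * (t - r)) (g s) x)
      (-(ε * P.op (ε * (t - s)) (P.gen (g s)) x)) (Icc 0 t) s := by
    have hi : HasDerivWithinAt (fun r => ε * (t - r)) (ε * (-1)) (Icc 0 t) s :=
      (((hasDerivAt_id s).const_sub t).const_mul ε).hasDerivWithinAt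
    have := HasDerivWithinAt.comp s (h.hasDerivWithinAt_op (hg s hs) (hmaps hs) x) hi hmaps
    refine (this.congr_deriv ?_)
    ring
  have hDc : ContinuousWithinAt (fun r => P.op (ε * (t - r)) D x) (Icc 0 t) s :=
    ((h.continuousOn hD x).comp (by fun_prop) hmaps) s hs
  have h2 : HasDerivWithinAt
      (fun r => P.op (ε * (t - r)) (g r) x - P.op (ε * (t - r)) (g s) x)
      (P.op (ε * (t - s)) D x) (Icc 0 t) s := by
    rw [hasDerivWithinAt_iff_isLittleO, Asymptotics.isLittleO_iff]
    intro η hη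
    filter_upwards [hder (η / 2) (by positivity), self_mem_nhdsWithin,
      Metric.continuousWithinAt_iff'.1 hDc (η / 2) (by positivity)] with r hr hrm hrD
    have hr0 : 0 ≤ ε * (t - r) := hmaps hrm
    have i1 := h.integrable (hg r hrm) hr0 x
    have i2 := h.integrable (hg s hs) hr0 x
    have i3 := (h.integrable hD hr0 x).const_mul (r - s)
    rw [Real.dist_eq] at hrD
    have e : P.op (ε * (t - r)) (g r) x - P.op (ε * (t - r)) (g s) x
        - (r - s) * P.op (ε * (t - r)) D x
        = P.op (ε * (t - r)) (fun y => g r y - g s y - (r - s) * D y) x := by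
      have j1 := integral_sub (i1.sub i2) i3
      have j2 := integral_sub i1 i2
      rw [integral_const_mul] at j1
      simp only [Pi.sub_apply] at j1
      rw [j2] at j1
      exact j1.symm
    have b1 := abs_op_le (P := P) hr0 hr x
    rw [← e] at b1
    have b2 : |(r - s) * (P.op (ε * (t - r)) D x - P.op (ε * (t - s)) D x)| ≤ η / 2 * |r - s| := by
      rw [abs_mul, mul_comm]
      exact mul_le_mul_of_nonneg_right hrD.le (abs_nonneg _)
    simp only [sub_self, sub_zero, smul_eq_mul, Real.norm_eq_abs]
    calc _ = |(P.op (ε * (t - r)) (g r) x - P.op (ε * (t - r)) (g s) x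
        - (r - s) * P.op (ε * (t - r)) D x)
        + (r - s) * (P.op (ε * (t - r)) D x - P.op (ε * (t - s)) D x)| := by congr 1; ring
      _ ≤ _ := (abs_add_le _ _).trans (by linarith)
  refine ((h1.add h2).congr_deriv (by ring)).congr (fun r _ => ?_) ?_ <;> simp

lemma IsDiffusion.carreDuChamp_mem (h : P.IsDiffusion A) {f g : E → ℝ} (hf : f ∈ A) (hg : g ∈ A) :
    P.carreDuChamp f g ∈ A := by
  have : P.carreDuChamp f g
      = (2⁻¹ : ℝ) • (P.gen (f * g) - f * P.gen g - g * P.gen f) := by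
    ext x
    simp only [carreDuChamp, Pi.smul_apply, Pi.sub_apply, Pi.mul_apply, smul_eq_mul]
    rw [div_eq_inv_mul]; rfl
  rw [this]
  exact A.smul_mem (A.sub_mem (A.sub_mem (h.gen_mem _ (A.mul_mem hf hg))
    (A.mul_mem hf (h.gen_mem _ hg))) (A.mul_mem hg (h.gen_mem _ hf))) _

lemma IsDiffusion.gen_exp (h : P.IsDiffusion A) {f : E → ℝ} (hf : f ∈ A) (a b : ℝ) (x : E) :
    P.gen (fun y => Real.exp (a * f y + b)) x =
      Real.exp (a * f x + b) * (a * P.gen f x + a ^ 2 * P.carreDuChamp f f x) := by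
  have d1 : deriv (fun z : ℝ => Real.exp (a * z + b)) = fun z => a * Real.exp (a * z + b) := by
    ext z
    have : HasDerivAt (fun z : ℝ => Real.exp (a * z + b)) (Real.exp (a * z + b) * (a * 1)) z :=
      (((hasDerivAt_id z).const_mul a).add_const b).exp
    rw [this.deriv]; ring
  have := h.chain_rule (fun z => Real.exp (a * z + b)) (by fun_prop) f hf x
  rw [this, d1, deriv_const_mul_field, d1]
  ring

/-- Comparison of a classical solution of the Hamilton-Jacobi equation with `v^ε`, up to `O(ε)`. -/
lemma IsClassicalHJ.comparison (h : P.IsDiffusion A) {T : ℝ} {f : E → ℝ} {v : ℝ → E → ℝ}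
    (hv : P.IsClassicalHJ A T f v) (hT : 0 ≤ T) {C : ℝ}
    (hC : ∀ s ∈ Icc 0 T, ∀ x, |P.gen (v s) x| ≤ C) {ε : ℝ} (hε : 0 < ε) (x : E) :
    |P.viscousHJ ε T f x - v T x| ≤ ε * C * T := by
  have hf : f ∈ A := hv.initial ▸ hv.mem 0 ⟨le_rfl, hT⟩
  set a : ℝ := -1 / (2 * ε) with ha
  have ha2 : a ^ 2 * ε = -a / 2 := by rw [ha]; field_simp
  have haε : a * ε = -1 / 2 := by rw [ha]; field_simp
  -- the derivative of the interpolation between the two functions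
  have key : ∀ σ : ℝ, ∀ s ∈ Icc 0 T, HasDerivWithinAt
      (fun r => P.op (ε * (T - r)) (fun y => Real.exp (a * v r y + σ * C / 2 * r)) x)
      (P.op (ε * (T - s)) (fun y => Real.exp (a * v s y + σ * C / 2 * s) *
        (P.gen (v s) y / 2 + σ * C / 2)) x) (Icc 0 T) s := by
    intro σ s hs
    have hvs := hv.mem s hs
    have hΓ := h.carreDuChamp_mem hvs hvs
    have hE := h.exp_mem hvs a (σ * C / 2 * s)
    set G : E → ℝ := fun y => Real.exp (a * v s y + σ * C / 2 * s) with hG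
    set W : E → ℝ := (-a / 2) • P.carreDuChamp (v s) (v s) + algebraMap ℝ (E → ℝ) (σ * C / 2)
      with hW
    have hWA : W ∈ A := A.add_mem (A.smul_mem hΓ _) (A.algebraMap_mem _)
    have hWx : ∀ y, W y = -a / 2 * P.carreDuChamp (v s) (v s) y + σ * C / 2 := fun y => rfl
    have hDA : G * W ∈ A := A.mul_mem hE hWA
    have hflow := h.hasDerivWithinAt_flow (ε := ε) (t := T) (s := s) hε.le
      (g := fun r y => Real.exp (a * v r y + σ * C / 2 * r))
      (fun r hr => h.exp_mem (hv.mem r hr) _ _) hDA hs ?_ x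
    · have hgen : P.gen G ∈ A := h.gen_mem _ hE
      refine hflow.congr_deriv ?_
      have hr0 : 0 ≤ ε * (T - s) := mul_nonneg hε.le (sub_nonneg.2 hs.2)
      change P.op (ε * (T - s)) (G * W) x - ε * P.op (ε * (T - s)) (P.gen G) x = _
      rw [← op_const_mul]
      have hεg : (fun y => ε * P.gen G y) ∈ A := A.smul_mem hgen ε
      rw [← h.op_sub hDA hεg hr0]
      congr 1
      ext y
      simp only [Pi.sub_apply, Pi.mul_apply, hWx]
      rw [hG, h.gen_exp hvs]
      linear_combination (-(Real.exp (a * v s y + σ * C / 2 * s)) *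
        P.carreDuChamp (v s) (v s) y) * ha2
        - (Real.exp (a * v s y + σ * C / 2 * s)) * P.gen (v s) y * haε
    · intro η hη
      obtain ⟨M, hM⟩ := h.bounded G hE
      obtain ⟨K, hK⟩ := h.bounded W hWA
      set M' := |M| + 1 with hM'
      set B := |a| + |K| + 1 with hB
      have hMp : 0 < M' := by positivity
      have hBp : 0 < B := by positivity
      have hap : 0 < |a| + 1 := by positivity
      set η' := min 1 (η / (2 * M' * (|a| + 1))) with hη'
      have hη'p : 0 < η' := lt_min one_pos (by positivity)
      have hη'1 : η' ≤ 1 := min_le_left _ _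
      have hη'2 : M' * (|a| * η') ≤ η / 2 := by
        have : η' * (2 * M' * (|a| + 1)) ≤ η := by
          rw [← le_div_iff₀ (by positivity)]; exact min_le_right _ _
        nlinarith [mul_pos hMp hη'p]
      have hsmall : ∀ᶠ r in 𝓝[Icc 0 T] s, |r - s| < min (1 / B) (η / (2 * M' * B ^ 2)) := by
        refine nhdsWithin_le_nhds ?_
        have := Metric.ball_mem_nhds s
          (lt_min (by positivity : 0 < 1 / B) (by positivity : 0 < η / (2 * M' * B ^ 2)))
        filter_upwards [this] with r hr
        rwa [Metric.mem_ball, Real.dist_eq] at hr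
      filter_upwards [hv.equation s hs η' hη'p, hsmall] with r hr hrs y
      set δ := r - s with hδ
      have hδ1 : B * |δ| ≤ 1 := by
        have := (hrs.trans_le (min_le_left _ _)).le
        rw [le_div_iff₀ hBp] at this; linarith
      have hδ2 : M' * (B ^ 2 * |δ|) ≤ η / 2 := by
        have := (hrs.trans_le (min_le_right _ _)).le
        rw [le_div_iff₀ (by positivity)] at this; nlinarith
      set β := a * (v r y - v s y) + σ * C / 2 * δ with hβ
      have hβ1 : |β - δ * W y| ≤ |a| * η' * |δ| := by
        have : β - δ * W y
            = a * (v r y - v s y - δ * (-(P.carreDuChamp (v s) (v s) y) / 2)) := by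
          rw [hβ, hWx]; ring
        rw [this, abs_mul, mul_assoc]
        exact mul_le_mul_of_nonneg_left (hr y) (abs_nonneg _)
      have hβ2 : |β| ≤ B * |δ| := by
        have e : β = (β - δ * W y) + δ * W y := by ring
        have hKy : |δ * W y| ≤ |K| * |δ| := by
          rw [abs_mul, mul_comm]
          exact mul_le_mul_of_nonneg_right ((hK y).trans (le_abs_self K)) (abs_nonneg _)
        rw [e]
        refine (abs_add_le _ _).trans ?_
        have : |a| * η' ≤ |a| := mul_le_of_le_one_right (abs_nonneg _) hη'1
        nlinarith [abs_nonneg δ]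
      have hexp := Real.abs_exp_sub_one_sub_id_le (hβ2.trans hδ1)
      have hsq : β ^ 2 ≤ B ^ 2 * |δ| * |δ| := by
        have := pow_le_pow_left₀ (abs_nonneg β) hβ2 2
        rw [sq_abs] at this; nlinarith
      have e1 : Real.exp (a * v r y + σ * C / 2 * r) = G y * Real.exp β := by
        rw [hG, ← Real.exp_add]; congr 1; rw [hβ, hδ]; ring
      have e2 : Real.exp (a * v r y + σ * C / 2 * r) - Real.exp (a * v s y + σ * C / 2 * s)
          - δ * (G * W) y = G y * ((Real.exp β - 1 - β) + (β - δ * W y)) := by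
        rw [e1, Pi.mul_apply]
        change G y * _ - G y - _ = _
        ring
      rw [e2, abs_mul]
      have hGM : |G y| ≤ M' := (hM y).trans ((le_abs_self M).trans (by linarith))
      calc |G y| * |(Real.exp β - 1 - β) + (β - δ * W y)|
          ≤ M' * (B ^ 2 * |δ| * |δ| + |a| * η' * |δ|) := by
            refine mul_le_mul hGM ((abs_add_le _ _).trans ?_) (abs_nonneg _) hMp.le
            exact add_le_add (hexp.trans hsq) hβ1
        _ = (M' * (B ^ 2 * |δ|) + M' * (|a| * η')) * |δ| := by ring
        _ ≤ η * |δ| := mul_le_mul_of_nonneg_right (by linarith) (abs_nonneg _)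
  have hcont : ∀ σ : ℝ, ContinuousOn
      (fun r => P.op (ε * (T - r)) (fun y => Real.exp (a * v r y + σ * C / 2 * r)) x)
      (Icc 0 T) := fun σ s hs => (key σ s hs).continuousWithinAt
  have e0 : ∀ σ : ℝ, P.op (ε * (T - 0)) (fun y => Real.exp (a * v 0 y + σ * C / 2 * 0)) x
      = P.op (ε * T) (fun y => Real.exp (-f y / (2 * ε))) x := by
    intro σ
    rw [hv.initial, sub_zero]
    congr 1
    ext y
    congr 1
    rw [ha]; ring
  have eT : ∀ σ : ℝ, P.op (ε * (T - T)) (fun y => Real.exp (a * v T y + σ * C / 2 * T)) x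
      = Real.exp (a * v T x + σ * C / 2 * T) := by
    intro σ
    rw [sub_self, mul_zero]
    exact op_zero (h.measurable _ (h.exp_mem (hv.mem T ⟨hT, le_rfl⟩) a _)) x
  set U := P.op (ε * T) (fun y => Real.exp (-f y / (2 * ε))) x with hU
  have hsub : interior (Icc 0 T) ⊆ Icc 0 T := interior_subset
  have hlow : Real.exp (a * v T x + (-1) * C / 2 * T) ≤ U := by
    have hanti := antitoneOn_of_hasDerivWithinAt_nonpos (convex_Icc 0 T) (hcont (-1))
      (fun s hs => (key (-1) s (hsub hs)).mono hsub) (fun s hs => ?_)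
    · have := hanti ⟨le_rfl, hT⟩ ⟨hT, le_rfl⟩ hT
      beta_reduce at this
      rwa [e0, eT] at this
    · refine integral_nonpos fun y => mul_nonpos_of_nonneg_of_nonpos (Real.exp_pos _).le ?_
      have := (abs_le.1 (hC s (hsub hs) y)).2
      linarith
  have hupp : U ≤ Real.exp (a * v T x + 1 * C / 2 * T) := by
    have hmono := monotoneOn_of_hasDerivWithinAt_nonneg (convex_Icc 0 T) (hcont 1)
      (fun s hs => (key 1 s (hsub hs)).mono hsub) (fun s hs => ?_)
    · have := hmono ⟨le_rfl, hT⟩ ⟨hT, le_rfl⟩ hT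
      beta_reduce at this
      rwa [e0, eT] at this
    · refine integral_nonneg fun y => mul_nonneg (Real.exp_pos _).le ?_
      have := (abs_le.1 (hC s (hsub hs) y)).1
      linarith
  have hUpos : 0 < U := (Real.exp_pos _).trans_le hlow
  have l1 := (Real.le_log_iff_exp_le hUpos).2 hlow
  have l2 := (Real.log_le_iff_le_exp hUpos).2 hupp
  have hvis : P.viscousHJ ε T f x = -2 * ε * Real.log U := rfl
  have m1 := mul_le_mul_of_nonneg_left l1 (by positivity : 0 ≤ 2 * ε)
  have m2 := mul_le_mul_of_nonneg_left l2 (by positivity : 0 ≤ 2 * ε)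
  have hav : 2 * ε * (a * v T x) = -v T x := by linear_combination 2 * v T x * haε
  rw [hvis, abs_le]
  constructor <;> nlinarith

/-- `Q_t f` is the solution of the Hamilton-Jacobi equation whenever a classical one exists. -/
theorem IsClassicalHJ.hamiltonJacobi_eq (h : P.IsDiffusion A) {T : ℝ} {f : E → ℝ}
    {v : ℝ → E → ℝ} (hv : P.IsClassicalHJ A T f v) {t : ℝ} (ht : t ∈ Icc 0 T) (x : E) :
    P.hamiltonJacobi t f x = v t x := by
  have hsub : Icc 0 t ⊆ Icc 0 T := Icc_subset_Icc_right ht.2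
  have hv' : P.IsClassicalHJ A t f v :=
    ⟨hv.initial, fun s hs => hv.mem s (hsub hs),
      fun s hs η hη => nhdsWithin_mono s hsub (hv.equation s (hsub hs) η hη),
      hv.bounded_gen.imp fun C hC s hs => hC s (hsub hs)⟩
  obtain ⟨C, hC⟩ := hv'.bounded_gen
  have hlim : Tendsto (fun ε => P.viscousHJ ε t f x) (𝓝[>] (0 : ℝ)) (𝓝 (v t x)) := by
    rw [tendsto_iff_dist_tendsto_zero]
    have h0 : Tendsto (fun ε : ℝ => ε * C * t) (𝓝[>] (0 : ℝ)) (𝓝 0) := by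
      have : Tendsto (fun ε : ℝ => ε * C * t) (𝓝 0) (𝓝 (0 * C * t)) :=
        Continuous.tendsto (by fun_prop) 0
      rw [zero_mul, zero_mul] at this
      exact this.mono_left nhdsWithin_le_nhds
    refine tendsto_of_tendsto_of_tendsto_of_le_of_le' tendsto_const_nhds h0
      (Eventually.of_forall fun _ => dist_nonneg) ?_
    filter_upwards [self_mem_nhdsWithin] with ε hε
    rw [Real.dist_eq]
    exact hv'.comparison h ht.1 hC hε x
  exact hlim.liminf_eq

lemma IsDiffusion.continuousOn_viscousHJ (h : P.IsDiffusion A) {f : E → ℝ} (hf : f ∈ A)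
    {t : ℝ} (ht : 0 ≤ t) (x : E) : ContinuousOn (fun ε => P.viscousHJ ε t f x) (Ioi 0) := by
  have hmem : ∀ ε : ℝ, (fun y => Real.exp (-f y / (2 * ε))) ∈ A := by
    intro ε
    have : (fun y => Real.exp (-f y / (2 * ε))) = fun y => Real.exp (-1 / (2 * ε) * f y + 0) := by
      ext y; congr 1; ring
    rw [this]
    exact h.exp_mem hf _ _
  have hpos : ∀ ε : ℝ, 0 < ε → 0 < P.op (ε * t) (fun y => Real.exp (-f y / (2 * ε))) x := by
    intro ε hε
    have := P.isMarkov (ε * t) (by positivity)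
    exact integral_exp_pos (h.integrable (hmem ε) (by positivity) x)
  obtain ⟨C, hC⟩ := h.bounded f hf
  have hop : ContinuousOn (fun ε => P.op (ε * t) (fun y => Real.exp (-f y / (2 * ε))) x)
      (Ioi 0) := by
    intro ε₀ hε₀
    obtain ⟨M, hM⟩ := h.bounded _ (hmem ε₀)
    set G : E → ℝ := fun y => Real.exp (-f y / (2 * ε₀)) with hG
    have c1 : ContinuousWithinAt (fun ε => P.op (ε * t) G x) (Ioi 0) ε₀ :=
      ((h.continuousOn (hmem ε₀) x).comp (g := fun s => P.op s G x) (f := fun ε => ε * t)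
        (s := Ioi 0) (by fun_prop) fun ε hε => mul_nonneg (le_of_lt hε) ht) ε₀ hε₀
    have hε₀' : (0 : ℝ) < ε₀ := hε₀
    have hb : Tendsto (fun ε : ℝ => |1 / (2 * ε₀) - 1 / (2 * ε)| * |C|) (𝓝[Ioi 0] ε₀) (𝓝 0) := by
      have : ContinuousAt (fun ε : ℝ => |1 / (2 * ε₀) - 1 / (2 * ε)| * |C|) ε₀ := by
        have : 2 * ε₀ ≠ 0 := by positivity
        fun_prop (disch := assumption)
      have := this.tendsto
      rw [sub_self, abs_zero, zero_mul] at this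
      exact this.mono_left nhdsWithin_le_nhds
    have c2 : Tendsto (fun ε => P.op (ε * t) (fun y => Real.exp (-f y / (2 * ε))) x
        - P.op (ε * t) G x) (𝓝[Ioi 0] ε₀) (𝓝 0) := by
      have hb' := (hb.const_mul (|M| * 2))
      rw [mul_zero] at hb'
      refine squeeze_zero_norm' ?_ hb'
      filter_upwards [self_mem_nhdsWithin, hb.eventually (gt_mem_nhds one_pos)] with ε hε hε1
      have hr0 : 0 ≤ ε * t := mul_nonneg (le_of_lt hε) ht
      rw [← h.op_sub (hmem ε) (hmem ε₀) hr0, Real.norm_eq_abs]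
      refine abs_op_le hr0 (fun y => ?_) x
      set β := (1 / (2 * ε₀) - 1 / (2 * ε)) * f y with hβ
      have hβ1 : |β| ≤ |1 / (2 * ε₀) - 1 / (2 * ε)| * |C| := by
        rw [hβ, abs_mul]
        exact mul_le_mul_of_nonneg_left ((hC y).trans (le_abs_self C)) (abs_nonneg _)
      have e : ((fun y => Real.exp (-f y / (2 * ε))) - G) y = G y * (Real.exp β - 1) := by
        simp only [Pi.sub_apply, hG, mul_sub, ← Real.exp_add, mul_one]
        congr 2
        rw [hβ]; ring
      rw [e, abs_mul, mul_assoc]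
      refine mul_le_mul ((hM y).trans (le_abs_self M)) ?_ (abs_nonneg _) (abs_nonneg _)
      exact (Real.abs_exp_sub_one_le (hβ1.trans hε1.le)).trans (by linarith)
    have c3 := c2.add c1.tendsto
    rw [zero_add] at c3
    exact c3.congr fun ε => by ring
  unfold viscousHJ
  exact (by fun_prop : ContinuousOn (fun ε : ℝ => -2 * ε) (Ioi 0)).mul
    (hop.log fun ε hε => (hpos ε hε).ne')

/-- `Q_t f` is measurable. -/
theorem IsDiffusion.measurable_hamiltonJacobi (h : P.IsDiffusion A) {f : E → ℝ} (hf : f ∈ A)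
    {t : ℝ} (ht : 0 ≤ t) : Measurable (P.hamiltonJacobi t f) := by
  have hev : ∀ (x : E) (a : ℝ), (∀ᶠ ε in 𝓝[>] (0 : ℝ), a ≤ P.viscousHJ ε t f x) ↔
      ∀ᶠ q : ℚ in comap ((↑) : ℚ → ℝ) (𝓝[>] (0 : ℝ)), a ≤ P.viscousHJ (q : ℝ) t f x := by
    intro x a
    refine ⟨fun H => H.comap _, fun H => ?_⟩
    have hbasis := (nhdsGT_basis (0 : ℝ)).comap ((↑) : ℚ → ℝ)
    obtain ⟨δ, hδ, hq⟩ := hbasis.eventually_iff.1 H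
    refine (nhdsGT_basis (0 : ℝ)).eventually_iff.2 ⟨δ, hδ, fun ε hε => ?_⟩
    have hc : ContinuousOn (fun ε => P.viscousHJ ε t f x) (Ioo 0 δ) :=
      (h.continuousOn_viscousHJ hf ht x).mono Ioo_subset_Ioi_self
    set R : Set ℝ := range (fun q : ℚ => (q : ℝ)) with hR
    have hcl : ε ∈ closure (Ioo 0 δ ∩ R) :=
      Dense.open_subset_closure_inter Rat.denseRange_cast isOpen_Ioo hε
    have hne : (𝓝[Ioo 0 δ ∩ R] ε).NeBot := mem_closure_iff_nhdsWithin_neBot.1 hcl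
    have hcw : ContinuousWithinAt (fun ε => P.viscousHJ ε t f x) (Ioo 0 δ ∩ R) ε :=
      (hc ε hε).mono inter_subset_left
    refine ge_of_tendsto hcw.tendsto ?_
    filter_upwards [self_mem_nhdsWithin] with r hr
    obtain ⟨hr1, q, rfl⟩ := hr
    exact hq hr1
  have hQ : P.hamiltonJacobi t f = fun x => liminf (fun q : ℚ => P.viscousHJ (q : ℝ) t f x)
      (comap ((↑) : ℚ → ℝ) (𝓝[>] (0 : ℝ))) := by
    ext x
    simp only [hamiltonJacobi, liminf_eq, hev]
  rw [hQ]
  have hm : ∀ q : ℚ, Measurable fun x => P.viscousHJ (q : ℝ) t f x := by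
    intro q
    unfold viscousHJ op
    have hg : Measurable fun y => Real.exp (-f y / (2 * (q : ℝ))) := by
      have := h.measurable f hf
      fun_prop
    have : Measurable fun x => ∫ y, Real.exp (-f y / (2 * (q : ℝ))) ∂(P.kernel (q * t) x) :=
      (hg.stronglyMeasurable.integral_kernel (κ := P.kernel (q * t))).measurable
    exact (this.log).const_mul _
  obtain ⟨u, hu⟩ := (comap ((↑) : ℚ → ℝ) (𝓝[>] (0 : ℝ))).exists_antitone_basis
  exact Measurable.liminf' hm ⟨hu.1, to_countable _⟩ fun j => to_countable _

end Consistency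

end MarkovSemigroup

end

/-! Both conditions are equivalent to a third one, the local logarithmic Sobolev inequality for
every `P_u`, `u > 0`: with `c(u) = ∫₀ᵘ e^{-2ρs} ds` and `g = e^f`, `P_u(g log g) - P_u g log P_u g ≤
c(u) P_u(g Γ(f))`. The relation between the exponents reads `q₁ = q₂ + t / (2c(u))`.

Curvature and log Sobolev (`localLogSobolev_of_CDInfty`, `CDInfty_of_localLogSobolev`): put `k_r =
P_r g`, `w_r = log k_r` and `F(r) = P_{u-r}(k_r log k_r)`. Then `F' = -P_{u-r}(k_r Γ(w_r))` and `F''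
= 2 P_{u-r}(k_r Γ₂(w_r))`, so `CD(ρ,∞)` gives `F'' ≥ -2ρF'`; comparison with the solution of the
equality case yields `F(0) + c(u)F'(0) ≤ F(u)`, which is the inequality. Conversely both sides of
the inequality agree to first order as `u → 0`, and the terms in `u²` give `ρΓ(f) ≤ Γ₂(f)`.

Log Sobolev to hypercontractivity (`viscous_hypercontractivity`, `hypercontractivity`): along `s ↦
P_{u+ε(t-s)}(e^{q(s) v^ε_s})^{1/q(s)}` with `q` affine, the derivative is an entropy minus an
energy, and the slope of `q` is chosen so that log Sobolev makes it nonpositive. Fatou's lemma then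
lets `ε → 0`.

Hypercontractivity to log Sobolev (`exists_le_hamiltonJacobi`,
`localLogSobolev_of_hypercontractivity`): take `q₂ = 1` and compare first-order terms as `t → 0`.
Since `Q_t f` need not be differentiable in `t`, it is replaced by the explicit lower bound `f -
(t/2)Γ(f) - Kt²`.

Derivatives of curves in the algebra are handled as expansions with remainders uniform in the space
variable, so that they can be integrated against the kernels. -/

namespace MarkovSemigroup

variable {E : Type*} [MeasurableSpace E] {P : MarkovSemigroup E} {A : Subalgebra ℝ (E → ℝ)}

/-! ### Algebra of `Γ` and `Γ₂` derived from the diffusion property of `L`. -/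

section GammaCalculus

lemma gen_eq_of_hasDerivWithinAt {f : E → ℝ} {x : E} {d : ℝ}
    (h : HasDerivWithinAt (fun t => P.op t f x) d (Ici 0) 0) : P.gen f x = d :=
  h.derivWithin (uniqueDiffOn_Ici (0 : ℝ) 0 self_mem_Ici)

lemma IsDiffusion.hasDerivWithinAt_gen (h : P.IsDiffusion A) {f : E → ℝ} (hf : f ∈ A) (x : E) :
    HasDerivWithinAt (fun t => P.op t f x) (P.gen f x) (Ici 0) 0 :=
  ((h.inDomain f hf).1 x).hasDerivWithinAt

lemma IsDiffusion.op_add_fun (h : P.IsDiffusion A) {f g : E → ℝ} (hf : f ∈ A) (hg : g ∈ A) {t : ℝ}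
    (ht : 0 ≤ t) (x : E) : P.op t (f + g) x = P.op t f x + P.op t g x :=
  integral_add (h.integrable hf ht x) (h.integrable hg ht x)

lemma IsDiffusion.gen_add (h : P.IsDiffusion A) {f g : E → ℝ} (hf : f ∈ A) (hg : g ∈ A) :
    P.gen (f + g) = P.gen f + P.gen g := by
  ext x
  refine gen_eq_of_hasDerivWithinAt
    (((h.hasDerivWithinAt_gen hf x).add (h.hasDerivWithinAt_gen hg x)).congr
      (fun t ht => h.op_add_fun hf hg ht x) (h.op_add_fun hf hg le_rfl x))

lemma IsDiffusion.gen_smul (h : P.IsDiffusion A) {f : E → ℝ} (hf : f ∈ A) (c : ℝ) :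
    P.gen (c • f) = c • P.gen f := by
  ext x
  exact gen_eq_of_hasDerivWithinAt (((h.hasDerivWithinAt_gen hf x).const_mul c).congr
      (fun t _ => op_const_mul c f t x) (op_const_mul c f 0 x))

lemma op_const {t : ℝ} (ht : 0 ≤ t) (c : ℝ) (x : E) : P.op t (fun _ => c) x = c := by
  have := P.isMarkov t ht
  simp [op]

lemma gen_const (c : ℝ) : P.gen (fun _ => c) = 0 := by
  ext x
  exact gen_eq_of_hasDerivWithinAt ((hasDerivWithinAt_const (0 : ℝ) (Ici 0) c).congr
    (fun t ht => op_const ht c x) (op_const le_rfl c x))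

lemma const_mem {F : Type*} (B : Subalgebra ℝ (F → ℝ)) (c : ℝ) : (fun _ => c) ∈ B :=
  B.algebraMap_mem c

lemma carreDuChamp_comm (f g : E → ℝ) : P.carreDuChamp f g = P.carreDuChamp g f := by
  ext x
  simp only [carreDuChamp, mul_comm (f _) (g _)]
  ring

/-- The product rule defining the carré du champ. -/
lemma gen_mul (f g : E → ℝ) :
    P.gen (f * g) = f * P.gen g + g * P.gen f + 2 * P.carreDuChamp f g := by
  ext x
  change P.gen (fun y => f y * g y) x = f x * P.gen g x + g x * P.gen f x
    + 2 * P.carreDuChamp f g x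
  simp only [carreDuChamp]
  ring

lemma IsDiffusion.carreDuChamp_add_left (h : P.IsDiffusion A) {f g k : E → ℝ} (hf : f ∈ A)
    (hg : g ∈ A) (hk : k ∈ A) :
    P.carreDuChamp (f + g) k = P.carreDuChamp f k + P.carreDuChamp g k := by
  ext x
  have e1 := congrFun (gen_mul (P := P) (f + g) k) x
  have e2 := congrFun (gen_mul (P := P) f k) x
  have e3 := congrFun (gen_mul (P := P) g k) x
  rw [add_mul, h.gen_add (A.mul_mem hf hk) (A.mul_mem hg hk), h.gen_add hf hg] at e1
  simp only [Pi.add_apply, Pi.mul_apply, Pi.ofNat_apply] at e1 e2 e3 ⊢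
  linarith

lemma IsDiffusion.carreDuChamp_smul_left (h : P.IsDiffusion A) {f k : E → ℝ} (hf : f ∈ A)
    (hk : k ∈ A) (c : ℝ) : P.carreDuChamp (c • f) k = c • P.carreDuChamp f k := by
  ext x
  have e1 := congrFun (gen_mul (P := P) (c • f) k) x
  have e2 := congrFun (gen_mul (P := P) f k) x
  rw [smul_mul_assoc, h.gen_smul (A.mul_mem hf hk), h.gen_smul hf] at e1
  simp only [Pi.add_apply, Pi.mul_apply, Pi.ofNat_apply, Pi.smul_apply, smul_eq_mul] at e1 e2 ⊢
  linear_combination c / 2 * e2 - e1 / 2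

lemma IsDiffusion.carreDuChamp_add_right (h : P.IsDiffusion A) {f g k : E → ℝ} (hf : f ∈ A)
    (hg : g ∈ A) (hk : k ∈ A) :
    P.carreDuChamp k (f + g) = P.carreDuChamp k f + P.carreDuChamp k g := by
  rw [carreDuChamp_comm, h.carreDuChamp_add_left hf hg hk, carreDuChamp_comm f, carreDuChamp_comm g]

lemma IsDiffusion.carreDuChamp_smul_right (h : P.IsDiffusion A) {f k : E → ℝ} (hf : f ∈ A)
    (hk : k ∈ A) (c : ℝ) : P.carreDuChamp k (c • f) = c • P.carreDuChamp k f := by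
  rw [carreDuChamp_comm, h.carreDuChamp_smul_left hf hk, carreDuChamp_comm f]

/-- After centring at `c = f x`, the square `(f - c)²` is minimal at `x` with value `0`, so `P_t` of
it can only grow from there and `L((f - c)²)(x) ≥ 0`; this number is `2Γ(f)(x)`. -/
lemma IsDiffusion.carreDuChamp_self_nonneg (h : P.IsDiffusion A) {f : E → ℝ} (hf : f ∈ A) (x : E) :
    0 ≤ P.carreDuChamp f f x := by
  set c := f x with hc
  have hfc : f + (fun _ => -c) ∈ A := A.add_mem hf (const_mem A _)
  have hgc : P.gen (f + fun _ => -c) = P.gen f := by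
    rw [h.gen_add hf (const_mem A _), gen_const, add_zero]
  have hcc : P.carreDuChamp f (fun _ => -c) x = 0 := by
    have e := congrFun (gen_mul (P := P) f (fun _ => -c)) x
    have e' : f * (fun _ => -c) = (-c) • f := by ext y; simp [mul_comm]
    rw [e', h.gen_smul hf, gen_const] at e
    simp only [Pi.add_apply, Pi.mul_apply, Pi.ofNat_apply, Pi.smul_apply, smul_eq_mul] at e
    linarith
  have e1 := congrFun (gen_mul (P := P) (f + fun _ => -c) (f + fun _ => -c)) x
  have hcc' : P.carreDuChamp (fun _ => -c) (fun _ => -c) x = 0 := by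
    simp only [carreDuChamp, gen_const]
    simp
  rw [hgc, h.carreDuChamp_add_left hf (const_mem A _) hfc, h.carreDuChamp_add_right hf (const_mem A _) hf,
    h.carreDuChamp_add_right hf (const_mem A _) (const_mem A _), carreDuChamp_comm (fun _ => -c) f] at e1
  simp only [Pi.add_apply, Pi.mul_apply, Pi.ofNat_apply, hcc, hcc', ← hc] at e1
  have hsq : (f + fun _ => -c) * (f + fun _ => -c) ∈ A := A.mul_mem hfc hfc
  have hnn : 0 ≤ P.gen ((f + fun _ => -c) * (f + fun _ => -c)) x := by
    have hd := h.hasDerivWithinAt_gen hsq x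
    rw [← hasDerivWithinAt_Ioi_iff_Ici, hasDerivWithinAt_iff_tendsto_slope' (by simp)] at hd
    refine ge_of_tendsto hd ?_
    filter_upwards [self_mem_nhdsWithin] with t ht
    rw [slope_def_field, op_zero (h.measurable _ hsq)]
    refine div_nonneg ?_ (sub_nonneg.2 (le_of_lt ht))
    have : 0 ≤ P.op t ((f + fun _ => -c) * (f + fun _ => -c)) x :=
      integral_nonneg fun y => mul_self_nonneg _
    simpa [← hc] using this
  linarith

/-- When `Γ(f)(x) = 0`, the nonnegative quantity `Γ(g + s f)(x)` is affine in `s`, so its slope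
vanishes. -/
lemma IsDiffusion.carreDuChamp_eq_zero (h : P.IsDiffusion A) {f g : E → ℝ} (hf : f ∈ A)
    (hg : g ∈ A) {x : E} (h0 : P.carreDuChamp f f x = 0) : P.carreDuChamp f g x = 0 := by
  have key : ∀ s : ℝ, 0 ≤ P.carreDuChamp g g x + 2 * s * P.carreDuChamp f g x := by
    intro s
    have hsf : s • f ∈ A := A.smul_mem hf s
    have := h.carreDuChamp_self_nonneg (A.add_mem hg hsf) x
    rw [h.carreDuChamp_add_left hg hsf (A.add_mem hg hsf), h.carreDuChamp_add_right hg hsf hg,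
      h.carreDuChamp_add_right hg hsf hsf, h.carreDuChamp_smul_left hf hsf,
      h.carreDuChamp_smul_left hf hg, h.carreDuChamp_smul_right hf hf,
      h.carreDuChamp_smul_right hf hg, carreDuChamp_comm g f] at this
    simp only [Pi.add_apply, Pi.smul_apply, smul_eq_mul, h0] at this
    linarith
  by_contra hne
  have := key (-(P.carreDuChamp g g x + 1) / (2 * P.carreDuChamp f g x))
  have e : 2 * (-(P.carreDuChamp g g x + 1) / (2 * P.carreDuChamp f g x)) * P.carreDuChamp f g x
    = -(P.carreDuChamp g g x + 1) := by field_simp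
  linarith

/-- The chain rule for the carré du champ, deduced from the one for the generator and from the
degenerate case of the Cauchy-Schwarz inequality. -/
lemma IsDiffusion.carreDuChamp_comp (h : P.IsDiffusion A) {φ : ℝ → ℝ} (hφ : ContDiff ℝ ∞ φ)
    {f g : E → ℝ} (hf : f ∈ A) (hg : g ∈ A) (x : E) :
    P.carreDuChamp (fun y => φ (f y)) g x = deriv φ (f x) * P.carreDuChamp f g x := by
  set c := deriv φ (f x) with hc
  -- Subtracting the tangent slope makes `ψ' (f x) = 0`. The chain rule for `L` applied to `ψ` and
  -- `ψ²` then gives `Γ(ψ(f))(x) = 0`, hence `Γ(ψ(f), g)(x) = 0`, and bilinearity concludes.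
  set ψ : ℝ → ℝ := fun z => φ z + (-c) * z with hψ
  have hψs : ContDiff ℝ ∞ ψ := hφ.add (contDiff_const.mul contDiff_id)
  have hφf := h.comp_mem φ hφ f hf
  have hψf := h.comp_mem ψ hψs f hf
  have e : (fun y => ψ (f y)) = (fun y => φ (f y)) + (-c) • f := by ext y; simp [hψ]
  have hdφ : Differentiable ℝ φ := hφ.differentiable (by simp)
  have hdψ : Differentiable ℝ ψ := hψs.differentiable (by simp)
  have hdψ' : Differentiable ℝ (deriv ψ) :=
    (hψs.deriv' (n := ∞)).differentiable (by simp)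
  have hψ0 : deriv ψ (f x) = 0 := by
    have : HasDerivAt ψ (c + (-c) * 1) (f x) :=
      (hdφ (f x)).hasDerivAt.add ((hasDerivAt_id _).const_mul (-c))
    rw [this.deriv]; ring
  have hdsq : deriv (fun z => ψ z * ψ z) = fun z => 2 * (ψ z * deriv ψ z) := by
    ext z
    rw [((hdψ z).hasDerivAt.fun_mul (hdψ z).hasDerivAt).deriv]
    ring
  have hddsq : deriv (deriv (fun z => ψ z * ψ z)) (f x) = 2 * (ψ (f x) * deriv (deriv ψ) (f x)) := by
    rw [hdsq]
    have := (((hdψ (f x)).hasDerivAt.fun_mul (hdψ' (f x)).hasDerivAt).const_mul 2).deriv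
    rw [this, hψ0]; ring
  have h0 : P.carreDuChamp (fun y => ψ (f y)) (fun y => ψ (f y)) x = 0 := by
    have e1 := h.chain_rule _ (hψs.mul hψs) f hf x
    have e2 := h.chain_rule _ hψs f hf x
    rw [hddsq, hdsq] at e1
    simp only [carreDuChamp, e2, hψ0] at e1 ⊢
    simp only [e1]
    ring
  have := h.carreDuChamp_eq_zero hψf hg h0
  rw [e, h.carreDuChamp_add_left hφf (A.smul_mem hf _) hg, h.carreDuChamp_smul_left hf hg] at this
  simp only [Pi.add_apply, Pi.smul_apply, smul_eq_mul] at this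
  linarith

lemma IsDiffusion.carreDuChamp_exp (h : P.IsDiffusion A) {f g : E → ℝ} (hf : f ∈ A) (hg : g ∈ A) :
    P.carreDuChamp (fun y => Real.exp (f y)) g = (fun y => Real.exp (f y)) * P.carreDuChamp f g := by
  ext x
  rw [h.carreDuChamp_comp Real.contDiff_exp hf hg x, Real.deriv_exp]
  rfl

lemma IsDiffusion.carreDuChamp_sq (h : P.IsDiffusion A) {f g : E → ℝ} (hf : f ∈ A) (hg : g ∈ A) :
    P.carreDuChamp (f * f) g = 2 * f * P.carreDuChamp f g := by
  ext x
  have := h.carreDuChamp_comp (φ := fun z => z * z) (contDiff_id.mul contDiff_id) hf hg x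
  have hd : deriv (fun z : ℝ => z * z) (f x) = 2 * f x := by
    rw [((hasDerivAt_id' (f x)).fun_mul (hasDerivAt_id' (f x))).deriv]; ring
  rw [hd] at this
  exact this

/-- Polarization of the rule for squares, itself the chain rule for `z ↦ z²`. -/
lemma IsDiffusion.carreDuChamp_mul (h : P.IsDiffusion A) {f g k : E → ℝ} (hf : f ∈ A)
    (hg : g ∈ A) (hk : k ∈ A) :
    P.carreDuChamp (f * g) k = f * P.carreDuChamp g k + g * P.carreDuChamp f k := by
  have hfg := A.mul_mem hf hg
  have e : (f + g) * (f + g) = f * f + (g * g + (2 : ℝ) • (f * g)) := by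
    ext x; simp; ring
  have e1 := h.carreDuChamp_sq (A.add_mem hf hg) hk
  rw [e, h.carreDuChamp_add_left (A.mul_mem hf hf) (A.add_mem (A.mul_mem hg hg)
    (A.smul_mem hfg _)) hk, h.carreDuChamp_add_left (A.mul_mem hg hg) (A.smul_mem hfg _) hk,
    h.carreDuChamp_smul_left hfg hk, h.carreDuChamp_sq hf hk, h.carreDuChamp_sq hg hk,
    h.carreDuChamp_add_left hf hg hk] at e1
  ext x
  have e2 := congrFun e1 x
  simp only [Pi.add_apply, Pi.smul_apply, smul_eq_mul, Pi.mul_apply, Pi.ofNat_apply] at e2 ⊢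
  linarith

/-- The second order operator that governs the second derivative of the entropy along the
semigroup is `2 e^w Γ₂(w)`. -/
lemma IsDiffusion.entropy_second_order (h : P.IsDiffusion A) {w k : E → ℝ} (hw : w ∈ A)
    (hk : k = fun y => Real.exp (w y)) :
    P.gen (P.gen (w * k)) - (2 : ℝ) • P.gen ((w + 1) * P.gen k)
      + ((w + 1) * P.gen (P.gen k) + (fun y => Real.exp (-w y)) * (P.gen k * P.gen k))
      = fun y => 2 * k y * P.gammaTwo w y := by
  have hkA : k ∈ A := by
    rw [hk]; exact h.comp_mem _ Real.contDiff_exp w hw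
  set l := P.gen w with hl
  set G := P.carreDuChamp w w with hG
  have hlA : l ∈ A := h.gen_mem w hw
  have hGA : G ∈ A := h.carreDuChamp_mem hw hw
  have hw1 : w + 1 ∈ A := A.add_mem hw A.one_mem
  have hΓk : ∀ g ∈ A, P.carreDuChamp k g = k * P.carreDuChamp w g := by
    intro g hg; rw [hk]; exact h.carreDuChamp_exp hw hg
  have hLk : P.gen k = k * (l + G) := by
    ext x
    have := h.gen_exp hw 1 0 x
    simp only [one_mul, add_zero, one_pow] at this
    rw [hk]
    exact this
  have hLkA : P.gen k ∈ A := h.gen_mem k hkA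
  have hM : l + G ∈ A := A.add_mem hlA hGA
  have hgw1 : P.gen (w + 1) = l := by
    have : (1 : E → ℝ) = fun _ => 1 := rfl
    rw [h.gen_add hw A.one_mem, this, gen_const, add_zero]
  have hΓw1 : P.carreDuChamp (w + 1) (P.gen k) = P.carreDuChamp w (P.gen k) := by
    have h1 : P.carreDuChamp 1 (P.gen k) = 0 := by
      have := gen_mul (P := P) 1 (P.gen k)
      have e0 : P.gen (1 : E → ℝ) = 0 := gen_const 1
      rw [one_mul, one_mul, e0] at this
      ext x
      have := congrFun this x
      simp only [Pi.add_apply, Pi.mul_apply, Pi.ofNat_apply] at this ⊢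
      linarith
    rw [h.carreDuChamp_add_left hw A.one_mem hLkA, h1, add_zero]
  have e1 : P.gen (w * k) = (w + 1) * P.gen k + k * G := by
    rw [gen_mul, carreDuChamp_comm w k, hΓk w hw]
    ext x
    have := congrFun hLk x
    simp only [Pi.add_apply, Pi.mul_apply, Pi.ofNat_apply] at this ⊢
    linarith
  have e2 : P.gen (P.gen (w * k)) = P.gen ((w + 1) * P.gen k) + P.gen (k * G) := by
    rw [e1, h.gen_add (A.mul_mem hw1 hLkA) (A.mul_mem hkA hGA)]
  have e3 : P.gen ((w + 1) * P.gen k)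
      = (w + 1) * P.gen (P.gen k) + P.gen k * l + 2 * P.carreDuChamp w (P.gen k) := by
    rw [gen_mul, hgw1, hΓw1]
  have e4 : P.gen (k * G) = k * P.gen G + G * P.gen k + 2 * (k * P.carreDuChamp w G) := by
    rw [gen_mul, hΓk G hGA]
  have e5 : P.carreDuChamp w (P.gen k)
      = k * (P.carreDuChamp w l + P.carreDuChamp w G) + (l + G) * (k * G) := by
    rw [hLk, carreDuChamp_comm, h.carreDuChamp_mul hkA hM hw, h.carreDuChamp_add_left hlA hGA hw,
      hΓk w hw, carreDuChamp_comm l, carreDuChamp_comm G]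
  have e6 : ∀ y, Real.exp (-w y) * k y = 1 := by
    intro y; rw [hk, ← Real.exp_add]; simp
  ext x
  have f2 := congrFun e2 x
  have f3 := congrFun e3 x
  have f4 := congrFun e4 x
  have f5 := congrFun e5 x
  have fL := congrFun hLk x
  simp only [Pi.add_apply, Pi.sub_apply, Pi.smul_apply, smul_eq_mul, Pi.mul_apply,
    Pi.ofNat_apply] at f2 f3 f4 f5 fL ⊢
  rw [f2, f3, f4, f5, fL]
  simp only [gammaTwo, ← hl, ← hG]
  -- Besides polynomial identities only `e^{-w} k = 1` is needed, to reduce `e^{-w} (Lk)²` to `k (Lw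
  -- + Γ(w))²`.
  linear_combination (k x * (l x + G x) * (l x + G x)) * e6 x

end GammaCalculus

end MarkovSemigroup

/-! ### Taylor estimates, the constant `c(u)` and a second-order comparison principle. -/

section RealAnalysis

lemma nonpos_of_forall_le_mul {x K d : ℝ} (hd : 0 < d)
    (h : ∀ δ, 0 < δ → δ ≤ d → x ≤ K * δ) : x ≤ 0 := by
  by_contra! hx
  have hK : 0 < |K| + 1 := by positivity
  have h1 : 0 < min d (x / (2 * (|K| + 1))) := lt_min hd (by positivity)
  have h2 := h _ h1 (min_le_left _ _)
  have h3 : min d (x / (2 * (|K| + 1))) * (2 * (|K| + 1)) ≤ x := by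
    rw [← le_div_iff₀ (by positivity)]; exact min_le_right _ _
  nlinarith [mul_le_mul_of_nonneg_right (le_abs_self K) h1.le]

/-- Mean value inequality on the segment from `a` to `b`, where `|x - a| ≤ |b - a|`. The constant is
not sharp, but it does not change with `n`, so `taylor_one` and `taylor_two` follow by applying this
to the function minus its Taylor polynomial. -/
lemma abs_sub_le_of_abs_deriv_le {S : Set ℝ} (hS : Convex ℝ S) {f d : ℝ → ℝ} {a b C : ℝ} (n : ℕ)
    (hC : 0 ≤ C) (hf : ∀ x ∈ S, HasDerivWithinAt f (d x) S x) (ha : a ∈ S) (hb : b ∈ S)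
    (hd : ∀ x ∈ S, |d x| ≤ C * |x - a| ^ n) : |f b - f a| ≤ C * |b - a| ^ (n + 1) := by
  have hsub : uIcc a b ⊆ S := hS.ordConnected.uIcc_subset ha hb
  have := Convex.norm_image_sub_le_of_norm_hasDerivWithin_le (C := C * |b - a| ^ n)
    (fun x hx => (hf x (hsub hx)).mono hsub) (fun x hx => ?_) (convex_uIcc a b)
    left_mem_uIcc right_mem_uIcc
  · simpa [Real.norm_eq_abs, pow_succ, mul_assoc] using this
  · exact (hd x (hsub hx)).trans (mul_le_mul_of_nonneg_left
      (pow_le_pow_left₀ (abs_nonneg _) (abs_sub_left_of_mem_uIcc hx) n) hC)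

lemma taylor_one {S : Set ℝ} (hS : Convex ℝ S) {f f₁ : ℝ → ℝ} {a b C : ℝ} (hC : 0 ≤ C)
    (hf : ∀ x ∈ S, HasDerivWithinAt f (f₁ x) S x)
    (hL : ∀ x ∈ S, |f₁ x - f₁ a| ≤ C * |x - a|) (ha : a ∈ S) (hb : b ∈ S) :
    |f b - f a - (b - a) * f₁ a| ≤ C * |b - a| ^ 2 := by
  have := abs_sub_le_of_abs_deriv_le hS (f := fun x => f x - (x - a) * f₁ a) (b := b) 1 hC
    (fun x hx => (hf x hx).sub (((hasDerivWithinAt_id x S).sub_const a).mul_const (f₁ a)))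
    ha hb (fun x hx => by simpa using hL x hx)
  simpa [sub_right_comm] using this

lemma taylor_two {S : Set ℝ} (hS : Convex ℝ S) {f f₁ f₂ : ℝ → ℝ} {a b C : ℝ} (hC : 0 ≤ C)
    (hf : ∀ x ∈ S, HasDerivWithinAt f (f₁ x) S x) (hf₁ : ∀ x ∈ S, HasDerivWithinAt f₁ (f₂ x) S x)
    (hL : ∀ x ∈ S, |f₂ x - f₂ a| ≤ C * |x - a|) (ha : a ∈ S) (hb : b ∈ S) :
    |f b - f a - (b - a) * f₁ a - (b - a) ^ 2 / 2 * f₂ a| ≤ C * |b - a| ^ 3 := by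
  have := abs_sub_le_of_abs_deriv_le hS
    (f := fun x => f x - (x - a) * f₁ a - (x - a) ^ 2 / 2 * f₂ a)
    (d := fun x => f₁ x - f₁ a - (x - a) * f₂ a) (b := b) 2 hC ?_
    ha hb (fun x hx => taylor_one hS hC hf₁ hL ha hx)
  · convert this using 2
    ring
  · intro x hx
    have hi := (hasDerivWithinAt_id x S).sub_const a
    have h2 := (((hi.fun_pow 2).div_const 2).mul_const (f₂ a))
    refine (((hf x hx).sub (hi.mul_const (f₁ a))).sub h2).congr_deriv ?_
    simp only [id]
    push_cast
    ring

/-- The constant `c(u) = ∫₀ᵘ e^{-2ρs} ds` of the local logarithmic Sobolev inequality. -/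
noncomputable def curvConst (ρ u : ℝ) : ℝ :=
  if ρ = 0 then u else (1 - Real.exp (-2 * ρ * u)) / (2 * ρ)

lemma curvConst_zero (ρ : ℝ) : curvConst ρ 0 = 0 := by simp [curvConst]

lemma hasDerivAt_exp_mul (c r : ℝ) :
    HasDerivAt (fun x => Real.exp (c * x)) (c * Real.exp (c * r)) r := by
  have := ((hasDerivAt_id' r).const_mul c).exp
  rwa [mul_one, mul_comm] at this

lemma hasDerivAt_curvConst (ρ u : ℝ) :
    HasDerivAt (curvConst ρ) (Real.exp (-2 * ρ * u)) u := by
  by_cases h : ρ = 0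
  · have : curvConst ρ = fun u => u := by ext; simp [curvConst, h]
    rw [this, h]
    simpa using hasDerivAt_id' u
  · have e : curvConst ρ = fun u => (1 - Real.exp (-2 * ρ * u)) / (2 * ρ) := by
      ext; simp [curvConst, h]
    rw [e]
    refine (((hasDerivAt_exp_mul (-2 * ρ) u).const_sub 1).div_const (2 * ρ)).congr_deriv ?_
    field_simp

lemma strictMono_curvConst (ρ : ℝ) : StrictMono (curvConst ρ) :=
  strictMono_of_hasDerivAt_pos (hasDerivAt_curvConst ρ) fun _ => Real.exp_pos _

lemma curvConst_pos (ρ : ℝ) {u : ℝ} (hu : 0 < u) : 0 < curvConst ρ u := by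
  have := strictMono_curvConst ρ hu
  rwa [curvConst_zero] at this

lemma continuous_curvConst (ρ : ℝ) : Continuous (curvConst ρ) :=
  continuous_iff_continuousAt.2 fun u => (hasDerivAt_curvConst ρ u).continuousAt

/-- A one variable Taylor expansion of order two on a compact interval. -/
lemma exists_taylor_two {f f₁ f₂ f₃ : ℝ → ℝ} (h : ∀ x, HasDerivAt f (f₁ x) x)
    (h₁ : ∀ x, HasDerivAt f₁ (f₂ x) x) (h₂ : ∀ x, HasDerivAt f₂ (f₃ x) x) (h₃ : Continuous f₃)
    (a u : ℝ) (ha : a ∈ Icc 0 u) : ∃ C, ∀ b ∈ Icc 0 u,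
      |f b - f a - (b - a) * f₁ a - (b - a) ^ 2 / 2 * f₂ a| ≤ C * |b - a| ^ 3 := by
  obtain ⟨C, hC⟩ := (isCompact_Icc (a := 0) (b := u)).exists_bound_of_continuousOn h₃.continuousOn
  have hC0 : 0 ≤ C := (norm_nonneg _).trans (hC a ha)
  refine ⟨C, fun b hb => taylor_two (convex_Icc 0 u) hC0 (fun x _ => (h x).hasDerivWithinAt)
    (fun x _ => (h₁ x).hasDerivWithinAt) (fun x hx => ?_) ha hb⟩
  have := abs_sub_le_of_abs_deriv_le (convex_Icc 0 u) (a := a) 0 hC0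
    (fun x _ => (h₂ x).hasDerivWithinAt) ha hx
    (fun x hx => by simpa using hC x hx)
  simpa using this

lemma curvConst_taylor (ρ a u : ℝ) (ha : a ∈ Icc 0 u) : ∃ C, ∀ b ∈ Icc 0 u,
    |curvConst ρ b - curvConst ρ a - (b - a) * Real.exp (-2 * ρ * a)
      - (b - a) ^ 2 / 2 * (-2 * ρ * Real.exp (-2 * ρ * a))| ≤ C * |b - a| ^ 3 :=
  exists_taylor_two (hasDerivAt_curvConst ρ) (hasDerivAt_exp_mul (-2 * ρ))
    (fun x => (hasDerivAt_exp_mul (-2 * ρ) x).const_mul (-2 * ρ)) (by fun_prop) a u ha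

/-- First and second order conditions at an interior maximum, for a function known only through its
expansion at that point. Expanding at `r ± δ` and dividing by `δ` gives `g₁ = 0`; adding the two
inequalities cancels `g₁` and gives the sign of `g₂`. -/
lemma peano_isMax {G : ℝ → ℝ} {u r C g₁ g₂ : ℝ} (hr : r ∈ Ioo 0 u)
    (hG : ∀ s ∈ Icc 0 u, |G s - G r - (s - r) * g₁ - (s - r) ^ 2 / 2 * g₂| ≤ C * |s - r| ^ 3)
    (hmax : ∀ s ∈ Icc 0 u, G s ≤ G r) : g₁ = 0 ∧ g₂ ≤ 0 := by
  obtain ⟨d, hd, hd1, hd2, hd3⟩ : ∃ d, 0 < d ∧ d ≤ r ∧ d ≤ u - r ∧ d ≤ 1 := by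
    refine ⟨min r (min (u - r) 1), lt_min hr.1 (lt_min (sub_pos.2 hr.2) one_pos), min_le_left _ _,
      (min_le_right _ _).trans (min_le_left _ _), (min_le_right _ _).trans (min_le_right _ _)⟩
  have hp : ∀ δ, 0 < δ → δ ≤ d → δ * g₁ + δ ^ 2 / 2 * g₂ ≤ C * δ ^ 3 := by
    intro δ h0 h1
    have hm : r + δ ∈ Icc 0 u := ⟨by linarith [hr.1], by linarith⟩
    have h2 := (abs_le.1 (hG _ hm)).1
    have h3 := hmax _ hm
    rw [add_sub_cancel_left, abs_of_pos h0] at h2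
    linarith
  have hn : ∀ δ, 0 < δ → δ ≤ d → -δ * g₁ + δ ^ 2 / 2 * g₂ ≤ C * δ ^ 3 := by
    intro δ h0 h1
    have hm : r + -δ ∈ Icc 0 u := ⟨by linarith [hr.1], by linarith [hr.2]⟩
    have h2 := (abs_le.1 (hG _ hm)).1
    have h3 := hmax _ hm
    rw [add_sub_cancel_left, abs_neg, abs_of_pos h0, neg_sq] at h2
    linarith
  have hsq : ∀ δ, 0 < δ → δ ≤ d → δ ^ 2 ≤ δ := fun δ h0 h1 => by nlinarith
  have hK : ∀ δ, 0 < δ → δ ≤ d → C * δ ^ 2 - δ / 2 * g₂ ≤ (|C| + |g₂|) * δ := by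
    intro δ h0 h1
    nlinarith [le_abs_self C, neg_abs_le g₂, hsq δ h0 h1, abs_nonneg C, abs_nonneg g₂,
      mul_le_mul_of_nonneg_right (le_abs_self C) (sq_nonneg δ),
      mul_le_mul_of_nonneg_left (hsq δ h0 h1) (abs_nonneg C)]
  have b1 : g₁ ≤ 0 := nonpos_of_forall_le_mul (K := |C| + |g₂|) hd fun δ h0 h1 => by
    refine le_trans ?_ (hK δ h0 h1)
    have := hp δ h0 h1
    nlinarith
  have b2 : -g₁ ≤ 0 := nonpos_of_forall_le_mul (K := |C| + |g₂|) hd fun δ h0 h1 => by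
    refine le_trans ?_ (hK δ h0 h1)
    have := hn δ h0 h1
    nlinarith
  have b3 : g₂ ≤ 0 := nonpos_of_forall_le_mul (K := 2 * C) hd fun δ h0 h1 => by
    have := hp δ h0 h1
    have := hn δ h0 h1
    have : δ ^ 2 * g₂ ≤ δ ^ 2 * (2 * C * δ) := by nlinarith
    exact le_of_mul_le_mul_left this (by positivity)
  exact ⟨by linarith, b3⟩

/-- A function with second order expansions such that `F'' ≥ -2ρ F'` lies above the solution of
`B'' = -2ρ B'` with the same initial data. -/
lemma le_of_peano_two {F a₁ a₂ : ℝ → ℝ} {ρ u : ℝ} (hu : 0 < u)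
    (hF : ∀ r ∈ Icc 0 u, ∃ C, ∀ s ∈ Icc 0 u,
      |F s - F r - (s - r) * a₁ r - (s - r) ^ 2 / 2 * a₂ r| ≤ C * |s - r| ^ 3)
    (ha : ∀ r ∈ Icc 0 u, -2 * ρ * a₁ r ≤ a₂ r) : F 0 + curvConst ρ u * a₁ 0 ≤ F u := by
  by_contra! hlt
  have hc := curvConst_pos ρ hu
  -- Maximum principle for `G = F - β c + η e^{Kr}`. Lowering the slope `a₁ 0` to `β` costs half of
  -- the gap and the exponential a quarter at `u`, so `G u < G 0` while the initial slope of `G` is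
  -- positive. The maximum is therefore interior.
  set gap := F 0 + curvConst ρ u * a₁ 0 - F u with hgap
  have hgap0 : 0 < gap := sub_pos.2 hlt
  set β := a₁ 0 - gap / (2 * curvConst ρ u) with hβ
  have hβu : curvConst ρ u * β = curvConst ρ u * a₁ 0 - gap / 2 := by
    rw [hβ]; field_simp
  have hβ0 : β < a₁ 0 := by
    have : 0 < gap / (2 * curvConst ρ u) := by positivity
    linarith
  -- Chosen so that `K + 2ρ > 0`, which makes `e^{Kr}` a strict subsolution: `(e^{Kr})'' +
  -- 2ρ(e^{Kr})' > 0`.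
  set K := 2 * |ρ| + 1 with hK
  have hK0 : 0 < K := by positivity
  have hKρ : 0 < K + 2 * ρ := by linarith [neg_abs_le ρ]
  set η := gap / (4 * Real.exp (K * u)) with hη
  have hη0 : 0 < η := by positivity
  have hηu : η * Real.exp (K * u) = gap / 4 := by rw [hη]; field_simp
  set G : ℝ → ℝ := fun r => F r - β * curvConst ρ r + η * Real.exp (K * r) with hG
  set g₁ : ℝ → ℝ := fun r => a₁ r - β * Real.exp (-2 * ρ * r) + η * (K * Real.exp (K * r)) with hg₁
  set g₂ : ℝ → ℝ := fun r =>
    a₂ r - β * (-2 * ρ * Real.exp (-2 * ρ * r)) + η * (K * (K * Real.exp (K * r))) with hg₂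
  have hPG : ∀ r ∈ Icc 0 u, ∃ C, ∀ s ∈ Icc 0 u,
      |G s - G r - (s - r) * g₁ r - (s - r) ^ 2 / 2 * g₂ r| ≤ C * |s - r| ^ 3 := by
    intro r hr
    obtain ⟨C₁, h1⟩ := hF r hr
    obtain ⟨C₂, h2⟩ := curvConst_taylor ρ r u hr
    obtain ⟨C₃, h3⟩ := exists_taylor_two (hasDerivAt_exp_mul K)
      (fun x => (hasDerivAt_exp_mul K x).const_mul K)
      (fun x => ((hasDerivAt_exp_mul K x).const_mul K).const_mul K) (by fun_prop) r u hr
    refine ⟨C₁ + |β| * C₂ + η * C₃, fun s hs => ?_⟩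
    have h2' := mul_le_mul_of_nonneg_left (h2 s hs) (abs_nonneg (-β))
    have h3' := mul_le_mul_of_nonneg_left (h3 s hs) (abs_nonneg η)
    rw [← abs_mul] at h2' h3'
    rw [abs_neg] at h2'
    rw [abs_of_pos hη0] at h3'
    have := (abs_add_three _ _ _).trans (add_le_add (add_le_add (h1 s hs) h2') h3')
    calc _ = _ := ?_
      _ ≤ _ := this
      _ = _ := by ring
    congr 1
    simp only [hG, hg₁, hg₂]
    ring
  have hcont : ContinuousOn G (Icc 0 u) := by
    intro r hr
    obtain ⟨C, hC⟩ := hPG r hr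
    have hl : Tendsto (fun s => G s - G r - (s - r) * g₁ r - (s - r) ^ 2 / 2 * g₂ r)
        (𝓝[Icc 0 u] r) (𝓝 0) := by
      refine squeeze_zero_norm' (a := fun s => C * |s - r| ^ 3) ?_ ?_
      · filter_upwards [self_mem_nhdsWithin] with s hs using hC s hs
      · have : Tendsto (fun s => C * |s - r| ^ 3) (𝓝 r) (𝓝 (C * |r - r| ^ 3)) :=
          Continuous.tendsto (by fun_prop) r
        simp only [sub_self, abs_zero, ne_eq, OfNat.ofNat_ne_zero, not_false_eq_true, zero_pow,
          mul_zero] at this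
        exact this.mono_left nhdsWithin_le_nhds
    have hl2 : Tendsto (fun s => G r + (s - r) * g₁ r + (s - r) ^ 2 / 2 * g₂ r)
        (𝓝[Icc 0 u] r) (𝓝 (G r)) := by
      have : Tendsto (fun s => G r + (s - r) * g₁ r + (s - r) ^ 2 / 2 * g₂ r) (𝓝 r)
          (𝓝 (G r + (r - r) * g₁ r + (r - r) ^ 2 / 2 * g₂ r)) :=
        Continuous.tendsto (by fun_prop) r
      simp only [sub_self, zero_mul, add_zero, ne_eq, OfNat.ofNat_ne_zero, not_false_eq_true,
        zero_pow, zero_div] at this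
      exact this.mono_left nhdsWithin_le_nhds
    have := hl.add hl2
    rw [zero_add] at this
    exact this.congr fun s => by ring
  obtain ⟨r, hr, hmax⟩ := isCompact_Icc.exists_isMaxOn (nonempty_Icc.2 hu.le) hcont
  have h0 : (0 : ℝ) ∈ Icc 0 u := ⟨le_rfl, hu.le⟩
  have hg10 : 0 < g₁ 0 := by
    simp only [hg₁, mul_zero, Real.exp_zero, mul_one]
    have := mul_pos hη0 hK0
    linarith
  have hG0 : G 0 = F 0 + η := by simp [hG, curvConst_zero]
  have hGu : G u < G 0 := by
    have : G u = F u - curvConst ρ u * β + gap / 4 := by simp only [hG, hηu]; ring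
    rw [this, hG0, hβu]
    linarith
  have hr0 : r ≠ 0 := by
    rintro rfl
    obtain ⟨C, hC⟩ := hPG 0 h0
    refine absurd hg10 (not_lt.2 ?_)
    refine nonpos_of_forall_le_mul (K := |C| + |g₂ 0|) (lt_min hu one_pos) fun δ hδ hδ1 => ?_
    have hm : δ ∈ Icc 0 u := ⟨hδ.le, hδ1.trans (min_le_left _ _)⟩
    have hd1 : δ ≤ 1 := hδ1.trans (min_le_right _ _)
    have h2 := (abs_le.1 (hC _ hm)).1
    have h3 : G δ ≤ G 0 := hmax hm
    rw [sub_zero, abs_of_pos hδ] at h2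
    have h4 : δ * g₁ 0 ≤ δ * (C * δ ^ 2 - δ / 2 * g₂ 0) := by nlinarith
    have h5 := le_of_mul_le_mul_left h4 hδ
    have h6 : C * δ ^ 2 ≤ |C| * δ := by
      have := mul_le_mul_of_nonneg_right (le_abs_self C) (sq_nonneg δ)
      have := mul_le_mul_of_nonneg_left (show δ ^ 2 ≤ δ by nlinarith) (abs_nonneg C)
      linarith
    nlinarith [neg_abs_le (g₂ 0), abs_nonneg (g₂ 0)]
  have hru : r ≠ u := by
    rintro rfl
    exact absurd (hmax h0) (not_le.2 hGu)
  obtain ⟨C, hC⟩ := hPG r hr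
  obtain ⟨m1, m2⟩ := peano_isMax ⟨lt_of_le_of_ne hr.1 (Ne.symm hr0), lt_of_le_of_ne hr.2 hru⟩ hC
    (fun s hs => hmax hs)
  have hpos : 0 < η * K * Real.exp (K * r) * (K + 2 * ρ) := by positivity
  have := ha r hr
  -- The term in `β` drops out because `c'' = -2ρ c'`; the right side is positive, against `g₁ r =
  -- 0` and `g₂ r ≤ 0`.
  have e : g₂ r + 2 * ρ * g₁ r = a₂ r + 2 * ρ * a₁ r + η * K * Real.exp (K * r) * (K + 2 * ρ) := by
    simp only [hg₁, hg₂]; ring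
  rw [m1] at e
  linarith

end RealAnalysis

namespace MarkovSemigroup

variable {E : Type*} [MeasurableSpace E] {P : MarkovSemigroup E} {A : Subalgebra ℝ (E → ℝ)}

/-! ### Expansions in time of the semigroup and of the entropy density, uniform in space. -/

section SemigroupExpansions

/-- Both sides are the derivative at `t = 0` of `P_{t+r} f`. -/
lemma IsDiffusion.gen_op (h : P.IsDiffusion A) {f : E → ℝ} (hf : f ∈ A) {r : ℝ} (hr : 0 ≤ r) :
    P.gen (P.op r f) = P.op r (P.gen f) := by
  ext x
  refine gen_eq_of_hasDerivWithinAt ?_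
  have h1 : HasDerivWithinAt (fun s => P.op s f x) (P.op r (P.gen f) x) (Ici 0) (0 + r) := by
    rw [zero_add]; exact h.hasDerivWithinAt_op hf hr x
  have hi : HasDerivWithinAt (fun t : ℝ => t + r) 1 (Ici 0) 0 :=
    ((hasDerivAt_id' (0 : ℝ)).add_const r).hasDerivWithinAt
  have h2 := HasDerivWithinAt.comp (0 : ℝ) h1 hi fun t ht => add_nonneg ht hr
  rw [mul_one] at h2
  exact h2.congr (fun t ht => (h.op_add hf ht hr x).symm) (h.op_add hf le_rfl hr x).symm

lemma IsDiffusion.exists_op_lipschitz (h : P.IsDiffusion A) {f : E → ℝ} (hf : f ∈ A) :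
    ∃ C, 0 ≤ C ∧ ∀ r s, 0 ≤ r → 0 ≤ s → ∀ x, |P.op s f x - P.op r f x| ≤ C * |s - r| := by
  obtain ⟨C, hC⟩ := h.lipschitz hf
  exact ⟨|C|, abs_nonneg C, fun r s hr hs x => (hC s r hs hr x).trans
    (mul_le_mul_of_nonneg_right (le_abs_self C) (abs_nonneg _))⟩

lemma IsDiffusion.exists_op_taylor_one (h : P.IsDiffusion A) {f : E → ℝ} (hf : f ∈ A) :
    ∃ C, 0 ≤ C ∧ ∀ r s, 0 ≤ r → 0 ≤ s → ∀ x,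
      |P.op s f x - P.op r f x - (s - r) * P.op r (P.gen f) x| ≤ C * |s - r| ^ 2 := by
  obtain ⟨C, hC0, hC⟩ := h.exists_op_lipschitz (h.gen_mem f hf)
  exact ⟨C, hC0, fun r s hr hs x => taylor_one (convex_Ici 0) hC0
    (fun t ht => h.hasDerivWithinAt_op hf ht x) (fun t ht => hC r t hr ht x) hr hs⟩

lemma IsDiffusion.exists_op_taylor_two (h : P.IsDiffusion A) {f : E → ℝ} (hf : f ∈ A) :
    ∃ C, 0 ≤ C ∧ ∀ r s, 0 ≤ r → 0 ≤ s → ∀ x,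
      |P.op s f x - P.op r f x - (s - r) * P.op r (P.gen f) x
        - (s - r) ^ 2 / 2 * P.op r (P.gen (P.gen f)) x| ≤ C * |s - r| ^ 3 := by
  have hg := h.gen_mem f hf
  obtain ⟨C, hC0, hC⟩ := h.exists_op_lipschitz (h.gen_mem _ hg)
  exact ⟨C, hC0, fun r s hr hs x => taylor_two (convex_Ici 0) hC0
    (fun t ht => h.hasDerivWithinAt_op hf ht x) (fun t ht => h.hasDerivWithinAt_op hg ht x)
    (fun t ht => hC r t hr ht x) hr hs⟩

/-- Second order expansion of `s ↦ P_{u-s} Y_s` when `Y_s` has a uniform one. -/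
lemma IsDiffusion.exists_op_flow_taylor_two (h : P.IsDiffusion A) {u r : ℝ} (hr : r ∈ Icc 0 u)
    {Y : ℝ → E → ℝ} {K₀ K₁ K₂ : E → ℝ} (hY : ∀ s ∈ Icc 0 u, Y s ∈ A) (hK₀ : K₀ ∈ A) (hK₁ : K₁ ∈ A)
    (hK₂ : K₂ ∈ A) {C : ℝ}
    (hC : ∀ s ∈ Icc 0 u, ∀ y,
      |Y s y - K₀ y - (s - r) * K₁ y - (s - r) ^ 2 / 2 * K₂ y| ≤ C * |s - r| ^ 3) (x : E) :
    ∃ C', ∀ s ∈ Icc 0 u,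
      |P.op (u - s) (Y s) x - P.op (u - r) K₀ x
        - (s - r) * (P.op (u - r) K₁ x - P.op (u - r) (P.gen K₀) x)
        - (s - r) ^ 2 / 2 * P.op (u - r)
          (P.gen (P.gen K₀) - (2 : ℝ) • P.gen K₁ + K₂) x| ≤ C' * |s - r| ^ 3 := by
  obtain ⟨C₀, hC₀, h0⟩ := h.exists_op_taylor_two hK₀
  obtain ⟨C₁, hC₁, h1⟩ := h.exists_op_taylor_one hK₁
  obtain ⟨C₂, hC₂, h2⟩ := h.exists_op_lipschitz hK₂
  refine ⟨C + C₀ + C₁ + C₂ / 2, fun s hs => ?_⟩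
  have hus : 0 ≤ u - s := sub_nonneg.2 hs.2
  have hur : 0 ≤ u - r := sub_nonneg.2 hr.2
  -- `Y_s` is replaced by its expansion under `P_{u-s}`; then `P_{u-s}` applied to `K₀`, `K₁`, `K₂`
  -- is expanded to order two, one and zero, as the factors `1`, `δ`, `δ²/2` supply the missing
  -- powers. Time runs backwards, whence the minus signs before odd-order terms.
  set δ := s - r with hδ
  have hδ' : u - s - (u - r) = -δ := by rw [hδ]; ring
  have b0 := h0 (u - r) (u - s) hur hus x
  have b1 := h1 (u - r) (u - s) hur hus x
  have b2 := h2 (u - r) (u - s) hur hus x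
  rw [hδ', abs_neg] at b0 b1 b2
  have hg0 := h.gen_mem _ (h.gen_mem _ hK₀)
  have hg1 := A.smul_mem (h.gen_mem _ hK₁) (2 : ℝ)
  have e1 : P.op (u - r) (P.gen (P.gen K₀) - (2 : ℝ) • P.gen K₁ + K₂) x
      = P.op (u - r) (P.gen (P.gen K₀)) x - 2 * P.op (u - r) (P.gen K₁) x
        + P.op (u - r) K₂ x := by
    rw [h.op_add_fun (A.sub_mem hg0 hg1) hK₂ hur, h.op_sub hg0 hg1 hur]
    congr 2
    exact op_const_mul 2 _ _ x
  have hδK₁ := A.smul_mem hK₁ δ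
  have hδK₂ := A.smul_mem hK₂ (δ ^ 2 / 2)
  have e2 : P.op (u - s) (Y s - K₀ - δ • K₁ - (δ ^ 2 / 2) • K₂) x
      = P.op (u - s) (Y s) x - P.op (u - s) K₀ x - δ * P.op (u - s) K₁ x
        - δ ^ 2 / 2 * P.op (u - s) K₂ x := by
    rw [h.op_sub (A.sub_mem (A.sub_mem (hY s hs) hK₀) hδK₁) hδK₂ hus,
      h.op_sub (A.sub_mem (hY s hs) hK₀) hδK₁ hus, h.op_sub (hY s hs) hK₀ hus]
    congr 2
    · exact op_const_mul _ _ _ x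
    · exact op_const_mul _ _ _ x
  have b3 := abs_op_le (P := P) hus (hC s hs) x
  change |P.op (u - s) (Y s - K₀ - δ • K₁ - (δ ^ 2 / 2) • K₂) x| ≤ _ at b3
  rw [e2] at b3
  have b1' := mul_le_mul_of_nonneg_left b1 (abs_nonneg δ)
  have b2' := mul_le_mul_of_nonneg_left b2 (abs_nonneg (δ ^ 2 / 2))
  rw [← abs_mul] at b1' b2'
  have hd2 : |δ ^ 2 / 2| = |δ| ^ 2 / 2 := by rw [abs_div, abs_pow]; norm_num
  rw [hd2] at b2'
  have := (abs_add_le _ _).trans (add_le_add ((abs_add_three _ _ _).trans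
    (add_le_add (add_le_add b3 b0) b1')) b2')
  calc _ = _ := ?_
    _ ≤ _ := this
    _ = _ := by ring
  congr 1
  rw [e1]
  ring

/-- The algebra is stable under functions smooth on all of `ℝ`, which `log` is not. The cut-off
vanishes below `m/2` and equals `1` above `m`, so nothing changes on functions bounded below by `m`.
-/
lemma contDiff_smoothTransition_mul_log {m : ℝ} (hm : 0 < m) :
    ContDiff ℝ ∞ fun z => Real.smoothTransition (2 * z / m - 1) * Real.log z := by
  rw [contDiff_iff_contDiffAt]
  intro z
  rcases lt_or_ge z (m / 2) with hz | hz
  · refine (contDiffAt_const (c := (0 : ℝ))).congr_of_eventuallyEq ?_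
    filter_upwards [gt_mem_nhds hz] with y hy
    have : 2 * y / m - 1 ≤ 0 := by
      rw [sub_nonpos, div_le_one hm]; linarith
    rw [Real.smoothTransition.zero_of_nonpos this, zero_mul]
  · have hz0 : z ≠ 0 := by linarith
    exact (Real.smoothTransition.contDiff.contDiffAt.comp z
      (by fun_prop : ContDiffAt ℝ ∞ (fun z => 2 * z / m - 1) z)).mul (Real.contDiffAt_log.2 hz0)

lemma IsDiffusion.log_mem (h : P.IsDiffusion A) {f : E → ℝ} (hf : f ∈ A) {m : ℝ} (hm : 0 < m)
    (hfm : ∀ x, m ≤ f x) : (fun x => Real.log (f x)) ∈ A := by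
  have := h.comp_mem _ (contDiff_smoothTransition_mul_log hm) f hf
  convert this using 2 with x
  have : 1 ≤ 2 * f x / m - 1 := by
    rw [le_sub_iff_add_le, le_div_iff₀ hm]; linarith [hfm x]
  rw [Real.smoothTransition.one_of_one_le this, one_mul]

lemma IsDiffusion.le_op (h : P.IsDiffusion A) {f : E → ℝ} (hf : f ∈ A) {m : ℝ}
    (hfm : ∀ x, m ≤ f x) {t : ℝ} (ht : 0 ≤ t) (x : E) : m ≤ P.op t f x := by
  have := op_mono h (const_mem A m) hf ht hfm x
  rwa [op_const ht] at this

lemma abs_inv_sub_inv_le {m a b : ℝ} (hm : 0 < m) (ha : m ≤ a) (hb : m ≤ b) :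
    |b⁻¹ - a⁻¹| ≤ (m ^ 2)⁻¹ * |b - a| := by
  have ha0 : 0 < a := hm.trans_le ha
  have hb0 : 0 < b := hm.trans_le hb
  rw [inv_sub_inv hb0.ne' ha0.ne', abs_div, abs_sub_comm, abs_of_pos (mul_pos hb0 ha0),
    div_eq_inv_mul]
  refine mul_le_mul_of_nonneg_right ?_ (abs_nonneg _)
  exact inv_anti₀ (by positivity) (by nlinarith)

lemma mul_log_taylor_two {m a b : ℝ} (hm : 0 < m) (ha : m ≤ a) (hb : m ≤ b) :
    |b * Real.log b - a * Real.log a - (b - a) * (Real.log a + 1) - (b - a) ^ 2 / 2 * a⁻¹|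
      ≤ (m ^ 2)⁻¹ * |b - a| ^ 3 :=
  taylor_two (convex_Ici m) (f := fun z => z * Real.log z) (f₁ := fun z => Real.log z + 1)
    (f₂ := fun z => z⁻¹) (by positivity)
    (fun z hz => (Real.hasDerivAt_mul_log (hm.trans_le hz).ne').hasDerivWithinAt)
    (fun z hz => ((Real.hasDerivAt_log (hm.trans_le hz).ne').add_const 1).hasDerivWithinAt)
    (fun z hz => abs_inv_sub_inv_le hm ha hz) ha hb

/-- Second order expansion of the entropy density `(P_s f) log (P_s f)` at `s = r`. -/
lemma IsDiffusion.exists_op_mul_log_taylor_two (h : P.IsDiffusion A) {f : E → ℝ} (hf : f ∈ A)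
    {m : ℝ} (hm : 0 < m) (hfm : ∀ x, m ≤ f x) {r : ℝ} (hr : 0 ≤ r) {w : E → ℝ} (hw : w ∈ A)
    (hwr : P.op r f = fun y => Real.exp (w y)) :
    ∃ C, ∀ s, 0 ≤ s → ∀ y,
      |P.op s f y * Real.log (P.op s f y) - (w * P.op r f) y
        - (s - r) * ((w + 1) * P.gen (P.op r f)) y
        - (s - r) ^ 2 / 2 * ((w + 1) * P.gen (P.gen (P.op r f))
          + (fun y => Real.exp (-w y)) * (P.gen (P.op r f) * P.gen (P.op r f))) y|
        ≤ C * |s - r| ^ 3 := by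
  have hgf := h.gen_mem f hf
  obtain ⟨C₁, hC₁, h1⟩ := h.exists_op_lipschitz hf
  obtain ⟨C₂, hC₂, h2⟩ := h.exists_op_taylor_two hf
  obtain ⟨C₃, hC₃, h3⟩ := h.exists_op_taylor_one hf
  obtain ⟨L, hL⟩ := h.bounded _ (h.op_mem r hr _ hgf)
  obtain ⟨W, hW⟩ := h.bounded _ (A.add_mem hw A.one_mem)
  rw [h.gen_op hf hr, h.gen_op hgf hr]
  refine ⟨(m ^ 2)⁻¹ * C₁ ^ 3 + W * C₂ + m⁻¹ * (C₃ * (C₁ + L)) / 2, fun s hs y => ?_⟩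
  have b1 := h1 r s hr hs y
  have b2 := h2 r s hr hs y
  have b3 := h3 r s hr hs y
  have hkr := h.le_op hf hfm hr y
  have b4 := mul_log_taylor_two hm hkr (h.le_op hf hfm hs y)
  have hlw : Real.log (P.op r f y) = w y := by rw [hwr, Real.log_exp]
  have hew : Real.exp (-w y) = (P.op r f y)⁻¹ := by rw [hwr, Real.exp_neg]
  simp only [Pi.add_apply, Pi.mul_apply, Pi.one_apply] at *
  have bL := hL y
  have bW := hW y
  rw [hlw] at b4
  rw [hew]
  set X := P.op s f y
  set k := P.op r f y
  set l := P.op r (P.gen f) y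
  set l₂ := P.op r (P.gen (P.gen f)) y
  set δ := s - r
  have hk0 : 0 < k := hm.trans_le hkr
  have hk1 : |k⁻¹ / 2| ≤ m⁻¹ / 2 := by
    rw [abs_of_pos (by positivity)]
    exact div_le_div_of_nonneg_right (inv_anti₀ hm hkr) (by norm_num)
  -- Three cubic errors: Taylor's formula for `z log z` at `k`, the expansion of `X - k` in the
  -- linear term, and `(X - k)² - (δl)²` in the quadratic term, factored as a difference of squares.
  have c1 : (m ^ 2)⁻¹ * |X - k| ^ 3 ≤ (m ^ 2)⁻¹ * (C₁ * |δ|) ^ 3 :=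
    mul_le_mul_of_nonneg_left (pow_le_pow_left₀ (abs_nonneg _) b1 3) (by positivity)
  have c2 : |(w y + 1) * (X - k - δ * l - δ ^ 2 / 2 * l₂)| ≤ W * (C₂ * |δ| ^ 3) := by
    rw [abs_mul]
    exact mul_le_mul bW b2 (abs_nonneg _) ((abs_nonneg _).trans bW)
  have c4 : |X - k + δ * l| ≤ (C₁ + L) * |δ| := by
    refine (abs_add_le _ _).trans ?_
    rw [abs_mul]
    nlinarith [mul_le_mul_of_nonneg_left bL (abs_nonneg δ)]
  have c3 : |k⁻¹ / 2 * ((X - k - δ * l) * (X - k + δ * l))|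
      ≤ m⁻¹ / 2 * (C₃ * |δ| ^ 2 * ((C₁ + L) * |δ|)) := by
    rw [abs_mul, abs_mul]
    refine mul_le_mul hk1 (mul_le_mul b3 c4 (abs_nonneg _) (by positivity))
      (by positivity) (by positivity)
  have := (abs_add_three _ _ _).trans (add_le_add (add_le_add (b4.trans c1) c2) c3)
  calc _ = _ := ?_
    _ ≤ _ := this
    _ = _ := by ring
  congr 1
  ring

end SemigroupExpansions

end MarkovSemigroup

namespace MarkovSemigroup

variable {E : Type*} [MeasurableSpace E] {P : MarkovSemigroup E} {A : Subalgebra ℝ (E → ℝ)}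

/-! ### Equivalence of the curvature condition with the local logarithmic Sobolev inequalities. -/

section LocalLogSobolev

/-- The local logarithmic Sobolev inequality at time `u` with constant `c`, for `e^f`. -/
def LocalLogSobolev (P : MarkovSemigroup E) (A : Subalgebra ℝ (E → ℝ)) (u c : ℝ) : Prop :=
  ∀ f ∈ A, ∀ x,
    P.op u (f * fun y => Real.exp (f y)) x
      - P.op u (fun y => Real.exp (f y)) x * Real.log (P.op u (fun y => Real.exp (f y)) x)
      ≤ c * P.op u ((fun y => Real.exp (f y)) * P.carreDuChamp f f) x

lemma IsDiffusion.exp_comp_mem (h : P.IsDiffusion A) {f : E → ℝ} (hf : f ∈ A) :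
    (fun x => Real.exp (f x)) ∈ A := h.comp_mem _ Real.contDiff_exp f hf

lemma IsDiffusion.exists_pos_le_exp (h : P.IsDiffusion A) {f : E → ℝ} (hf : f ∈ A) :
    ∃ m, 0 < m ∧ ∀ x, m ≤ Real.exp (f x) := by
  obtain ⟨C, hC⟩ := h.bounded f hf
  exact ⟨Real.exp (-C), Real.exp_pos _, fun x => Real.exp_le_exp.2 (abs_le.1 (hC x)).1⟩

/-- `L Φ(k) - Φ'(k) L k = k Γ(log k)` for `Φ(x) = x log x`. -/
lemma IsDiffusion.entropy_first_order (h : P.IsDiffusion A) {w k : E → ℝ} (hw : w ∈ A)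
    (hk : k = fun y => Real.exp (w y)) :
    P.gen (w * k) - (w + 1) * P.gen k = k * P.carreDuChamp w w := by
  have hΓ : P.carreDuChamp k w = k * P.carreDuChamp w w := by
    rw [hk]; exact h.carreDuChamp_exp hw hw
  have hLk : P.gen k = k * (P.gen w + P.carreDuChamp w w) := by
    ext x
    have := h.gen_exp hw 1 0 x
    simp only [one_mul, add_zero, one_pow] at this
    rw [hk]
    exact this
  rw [gen_mul, carreDuChamp_comm w k, hΓ]
  ext x
  have := congrFun hLk x
  simp only [Pi.add_apply, Pi.sub_apply, Pi.mul_apply, Pi.ofNat_apply] at this ⊢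
  linarith

lemma IsDiffusion.gammaTwo_mem (h : P.IsDiffusion A) {f : E → ℝ} (hf : f ∈ A) :
    P.gammaTwo f ∈ A := by
  have e : P.gammaTwo f = (2⁻¹ : ℝ) • (P.gen (P.carreDuChamp f f)
      - (2 : ℝ) • P.carreDuChamp f (P.gen f)) := by
    ext x
    simp only [gammaTwo, Pi.smul_apply, Pi.sub_apply, smul_eq_mul]
    ring
  rw [e]
  exact A.smul_mem (A.sub_mem (h.gen_mem _ (h.carreDuChamp_mem hf hf))
    (A.smul_mem (h.carreDuChamp_mem hf (h.gen_mem f hf)) _)) _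

/-- The curvature condition implies the local logarithmic Sobolev inequalities. -/
theorem IsDiffusion.localLogSobolev_of_CDInfty (h : P.IsDiffusion A) {ρ : ℝ}
    (hCD : P.CDInfty A ρ) {u : ℝ} (hu : 0 < u) : P.LocalLogSobolev A u (curvConst ρ u) := by
  intro f hf x
  set g : E → ℝ := fun y => Real.exp (f y) with hg
  have hgA : g ∈ A := h.exp_comp_mem hf
  obtain ⟨m, hm, hgm⟩ := h.exists_pos_le_exp hf
  set k : ℝ → E → ℝ := fun r => P.op r g with hk
  set w : ℝ → E → ℝ := fun r y => Real.log (k r y) with hwdef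
  have hkA : ∀ r, 0 ≤ r → k r ∈ A := fun r hr => h.op_mem r hr g hgA
  have hkm : ∀ r, 0 ≤ r → ∀ y, m ≤ k r y := fun r hr y => h.le_op hgA hgm hr y
  have hwA : ∀ r, 0 ≤ r → w r ∈ A := fun r hr => h.log_mem (hkA r hr) hm (hkm r hr)
  have hkw : ∀ r, 0 ≤ r → k r = fun y => Real.exp (w r y) := fun r hr => by
    ext y; exact (Real.exp_log (hm.trans_le (hkm r hr y))).symm
  have hk0 : k 0 = g := by ext y; exact op_zero (h.measurable g hgA) y
  have hw0 : w 0 = f := by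
    ext y; simp only [hwdef, hk0, hg, Real.log_exp]
  -- `a₁` and `a₂` play the roles of `F'` and `F''`. The endpoints give `F 0 = P_u(g log g)` and `F
  -- u = P_u g log P_u g`, and `-a₁ 0` is the energy `P_u(g Γ(f))`.
  have main := le_of_peano_two (F := fun r => P.op (u - r) (fun y => k r y * Real.log (k r y)) x)
    (a₁ := fun r => -P.op (u - r) (k r * P.carreDuChamp (w r) (w r)) x)
    (a₂ := fun r => P.op (u - r) (fun y => 2 * k r y * P.gammaTwo (w r) y) x) (ρ := ρ) hu ?_ ?_
  · simp only [sub_zero, sub_self, hk0, hw0, hg, Real.log_exp] at main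
    have e1 : P.op 0 (fun y => k u y * Real.log (k u y)) x = k u x * Real.log (k u x) :=
      op_zero (h.measurable _ (A.mul_mem (hkA u hu.le) (hwA u hu.le))) x
    have e2 : (fun y => Real.exp (f y) * f y) = f * g := by ext y; exact mul_comm _ _
    rw [e1, e2] at main
    change P.op u (f * g) x - k u x * Real.log (k u x) ≤ _
    linarith
  · intro r hr
    have hr0 := hr.1
    have hur : 0 ≤ u - r := sub_nonneg.2 hr.2
    have hw := hwA r hr0
    have hkr := hkA r hr0
    have hgk := h.gen_mem _ hkr
    have hw1 := A.add_mem hw A.one_mem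
    have hK₁ := A.mul_mem hw1 hgk
    have hK₀ := A.mul_mem hw hkr
    have hnw : (fun y => Real.exp (-w r y)) ∈ A := by
      simpa using h.exp_mem hw (-1) 0
    have hK₂ := A.add_mem (A.mul_mem hw1 (h.gen_mem _ hgk)) (A.mul_mem hnw (A.mul_mem hgk hgk))
    obtain ⟨C, hC⟩ := h.exists_op_mul_log_taylor_two hgA hm hgm hr0 hw (hkw r hr0)
    obtain ⟨C', hC'⟩ := h.exists_op_flow_taylor_two hr
      (Y := fun s y => k s y * Real.log (k s y))
      (fun s hs => A.mul_mem (hkA s hs.1) (hwA s hs.1)) hK₀ hK₁ hK₂ (fun s hs => hC s hs.1) x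
    refine ⟨C', fun s hs => ?_⟩
    have := hC' s hs
    have e0 : (fun y => k r y * Real.log (k r y)) = w r * k r := by
      ext y; exact mul_comm _ _
    -- The coefficients produced by the flow expansion are recognised as `2kΓ₂(w)` and, up to sign,
    -- `kΓ(w)`.
    rw [h.entropy_second_order hw (hkw r hr0), ← h.op_sub hK₁ (h.gen_mem _ hK₀) hur,
      ← neg_sub (P.gen _), h.entropy_first_order hw (hkw r hr0)] at this
    rw [e0]
    convert this using 5
    exact (integral_neg _).symm
  · intro r hr
    have hr0 := hr.1
    have hur : 0 ≤ u - r := sub_nonneg.2 hr.2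
    have hw := hwA r hr0
    have hkr := hkA r hr0
    have hΓ := A.mul_mem hkr (h.carreDuChamp_mem hw hw)
    have h2 : (fun y => 2 * k r y * P.gammaTwo (w r) y) ∈ A := by
      have := A.smul_mem (A.mul_mem hkr (h.gammaTwo_mem hw)) (2 : ℝ)
      convert this using 1
      ext y
      simp [mul_assoc]
    have := op_mono h (A.smul_mem hΓ (2 * ρ)) h2 hur (fun y => ?_) x
    · have e : P.op (u - r) ((2 * ρ) • (k r * P.carreDuChamp (w r) (w r))) x
        = 2 * ρ * P.op (u - r) (k r * P.carreDuChamp (w r) (w r)) x := op_const_mul _ _ _ x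
      rw [e] at this
      linarith
    · simp only [Pi.smul_apply, Pi.mul_apply, smul_eq_mul]
      have := mul_le_mul_of_nonneg_left (hCD _ hw y) (hm.trans_le (hkm r hr0 y)).le
      linarith

/-- The local logarithmic Sobolev inequalities for small times imply the curvature condition. -/
theorem IsDiffusion.CDInfty_of_localLogSobolev (h : P.IsDiffusion A) {ρ : ℝ}
    (hLS : ∀ u, 0 < u → P.LocalLogSobolev A u (curvConst ρ u)) : P.CDInfty A ρ := by
  intro f hf x
  set g : E → ℝ := fun y => Real.exp (f y) with hg
  have hgA : g ∈ A := h.exp_comp_mem hf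
  obtain ⟨m, hm, hgm⟩ := h.exists_pos_le_exp hf
  have h0g : P.op 0 g = g := by ext y; exact op_zero (h.measurable g hgA) y
  have hN := A.mul_mem hgA (h.carreDuChamp_mem hf hf)
  have hfg := A.mul_mem hf hgA
  obtain ⟨C₁, hC₁⟩ := h.exists_op_mul_log_taylor_two hgA hm hgm le_rfl hf h0g
  obtain ⟨C₂, -, hC₂⟩ := h.exists_op_taylor_two hfg
  obtain ⟨C₃, hC₃0, hC₃⟩ := h.exists_op_taylor_one hN
  obtain ⟨C₄, hC₄⟩ := curvConst_taylor ρ 0 1 ⟨le_rfl, zero_le_one⟩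
  obtain ⟨M, hM⟩ := h.bounded _ hN
  have hfirst := congrFun (h.entropy_first_order hf hg) x
  have hsecond := congrFun (h.entropy_second_order hf hg) x
  -- `L` applied to the first-order identity `g Γ(f) = L(fg) - (f + 1) Lg`.
  have hgenN : P.gen (g * P.carreDuChamp f f) x
      = P.gen (P.gen (f * g)) x - P.gen ((f + 1) * P.gen g) x := by
    have hf1 := A.mul_mem (A.add_mem hf A.one_mem) (h.gen_mem g hgA)
    have e : P.gen (f * g) = g * P.carreDuChamp f f + (f + 1) * P.gen g := by
      rw [← h.entropy_first_order hf hg]; simp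
    rw [e, h.gen_add hN hf1]
    simp
  set N := (g * P.carreDuChamp f f) x with hNdef
  set c := curvConst ρ with hcdef
  have hz : ∀ F ∈ A, P.op 0 F x = F x := fun F hF => op_zero (h.measurable F hF) x
  set V := 2 * g x * P.gammaTwo f x with hV
  set LN := P.gen (g * P.carreDuChamp f f) x with hLN
  suffices hs : ρ * N - V / 2 ≤ 0 by
    have hgx : 0 < g x := Real.exp_pos _
    have : g x * (ρ * P.carreDuChamp f f x - P.gammaTwo f x) ≤ 0 := by
      have e : N = g x * P.carreDuChamp f f x := rfl
      rw [e, hV] at hs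
      linarith
    have := nonpos_of_mul_nonpos_right this hgx
    linarith
  -- `c(u) = u - ρu² + O(u³)`; the coefficient `-ρ` is where the curvature bound enters.
  have hc1 : ∀ u, 0 < u → u ≤ 1 → |c u - u + ρ * u ^ 2| ≤ C₄ * u ^ 3 := by
    intro u h0 h1
    have := hC₄ u ⟨h0.le, h1⟩
    rw [hcdef, curvConst_zero] at this
    simp only [sub_zero, mul_zero, Real.exp_zero, mul_one, abs_of_pos h0] at this
    convert this using 2
    ring
  refine nonpos_of_forall_le_mul (d := 1)
    (K := |C₁| + |C₂| + |ρ| * |LN| + C₃ * (1 + |ρ|) + C₄ * M) one_pos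
    fun u h0 h1 => ?_
  have hLSu := hLS u h0 f hf x
  have b1 := hC₁ u h0.le x
  have b2 := hC₂ 0 u le_rfl h0.le x
  have b3 := hC₃ 0 u le_rfl h0.le x
  have b4 := hc1 u h0 h1
  have b5 := abs_op_le (P := P) h0.le hM x
  rw [h0g] at b1
  rw [hz _ hfg, hz _ (h.gen_mem _ hfg), hz _ (h.gen_mem _ (h.gen_mem _ hfg))] at b2
  rw [hz _ hN, hz _ (h.gen_mem _ hN)] at b3
  simp only [sub_zero, abs_of_pos h0] at b1 b2 b3
  change _ ≤ c u * P.op u (g * P.carreDuChamp f f) x at hLSu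
  change P.op u (f * g) x - P.op u g x * Real.log (P.op u g x) ≤ _ at hLSu
  simp only [Pi.add_apply, Pi.sub_apply, Pi.smul_apply, smul_eq_mul] at hfirst hsecond
  rw [Pi.add_apply] at b1
  rw [← hNdef, ← hLN] at b3
  set R := P.op u (g * P.carreDuChamp f f) x
  set K₁ := ((f + 1) * P.gen g) x
  set I := P.op u (f * g) x
  set Φ := P.op u g x * Real.log (P.op u g x)
  have a1 := (abs_le.1 (b1.trans (mul_le_mul_of_nonneg_right (le_abs_self C₁) (by positivity)))).2
  have a2 := (abs_le.1 (b2.trans (mul_le_mul_of_nonneg_right (le_abs_self C₂) (by positivity)))).1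
  have a3 : (u - ρ * u ^ 2) * (R - N - u * LN) ≤ (1 + |ρ|) * u * (C₃ * u ^ 2) := by
    refine (le_abs_self _).trans ?_
    rw [abs_mul]
    refine mul_le_mul ?_ b3 (abs_nonneg _) (by positivity)
    refine (abs_sub _ _).trans ?_
    rw [abs_mul, abs_of_pos h0, abs_of_nonneg (sq_nonneg u)]
    have := mul_le_mul_of_nonneg_left (show u ^ 2 ≤ u by nlinarith) (abs_nonneg ρ)
    linarith
  have a4 : (c u - u + ρ * u ^ 2) * R ≤ C₄ * u ^ 3 * M := by
    refine (le_abs_self _).trans ?_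
    rw [abs_mul]
    exact mul_le_mul b4 b5 (abs_nonneg _) ((abs_nonneg _).trans b4)
  have a5 : -(ρ * LN) ≤ |ρ| * |LN| := by
    rw [← abs_mul]; exact neg_le_abs _
  have a5' := mul_le_mul_of_nonneg_left a5 (by positivity : 0 ≤ u ^ 3)
  -- With `N = gΓ(f)` and `V = 2gΓ₂(f)` at `x`, the entropy is `uN + u²(LN - V/2) + O(u³)` and the
  -- right side is `uN + u²(LN - ρN) + O(u³)`. The terms `uN` and `u² LN` cancel.
  have : u ^ 2 * (ρ * N - V / 2)
      ≤ u ^ 2 * ((|C₁| + |C₂| + |ρ| * |LN| + C₃ * (1 + |ρ|) + C₄ * M) * u) := by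
    have e1 : P.gen (f * g) x = N + K₁ := by linarith
    rw [e1] at a2
    linear_combination hLSu + a1 + a2 + a3 + a4 + a5' + u ^ 2 * hgenN + u ^ 2 / 2 * hsecond
  exact le_of_mul_le_mul_left this (by positivity)

end LocalLogSobolev

end MarkovSemigroup

namespace MarkovSemigroup

variable {E : Type*} [MeasurableSpace E] {P : MarkovSemigroup E} {A : Subalgebra ℝ (E → ℝ)}

/-! ### Calculus of curves with quadratic remainder and hypercontractivity at positive viscosity. -/

section Hypercontractivity

/-- The curve `g` on `[0, T]` has derivative `D` at `s` in the sup norm, with a quadratic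
remainder. -/
def HasQuadDeriv {F : Type*} (g : ℝ → F → ℝ) (D : F → ℝ) (T s : ℝ) : Prop :=
  ∃ C, 0 ≤ C ∧ ∀ r ∈ Icc 0 T, ∀ y, |g r y - g s y - (r - s) * D y| ≤ C * |r - s| ^ 2

/-- Bridge to the hypothesis of `hasDerivWithinAt_flow`; the quadratic form is the one that is easy
to propagate through compositions. -/
lemma HasQuadDeriv.eventually_le {F : Type*} {g : ℝ → F → ℝ} {D : F → ℝ} {T s : ℝ}
    (hg : HasQuadDeriv g D T s) {η : ℝ} (hη : 0 < η) :
    ∀ᶠ r in 𝓝[Icc 0 T] s, ∀ y, |g r y - g s y - (r - s) * D y| ≤ η * |r - s| := by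
  obtain ⟨C, hC0, hC⟩ := hg
  have hsmall : ∀ᶠ r in 𝓝[Icc 0 T] s, |r - s| < η / (C + 1) := by
    refine nhdsWithin_le_nhds ?_
    filter_upwards [Metric.ball_mem_nhds s (by positivity : 0 < η / (C + 1))] with r hr
    rwa [Metric.mem_ball, Real.dist_eq] at hr
  filter_upwards [hsmall, self_mem_nhdsWithin] with r hr hrT y
  refine (hC r hrT y).trans ?_
  rw [lt_div_iff₀ (by positivity)] at hr
  nlinarith [abs_nonneg (r - s)]

/-- Taylor's formula for `φ`, whose derivative is Lipschitz on `S`: the increment of `g` is at most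
`(|M| + C T)|r - s|` since `|r - s| ≤ T`, so the error in linearising `φ` is again quadratic. -/
lemma HasQuadDeriv.comp {F : Type*} {g : ℝ → F → ℝ} {D : F → ℝ} {T s : ℝ}
    (hg : HasQuadDeriv g D T s) (hs : s ∈ Icc 0 T) (hD : ∃ M, ∀ y, |D y| ≤ M) {S : Set ℝ}
    (hS : Convex ℝ S) (hgS : ∀ r ∈ Icc 0 T, ∀ y, g r y ∈ S) {φ φ' : ℝ → ℝ} {L B : ℝ}
    (hL0 : 0 ≤ L) (hφ : ∀ z ∈ S, HasDerivAt φ (φ' z) z)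
    (hL : ∀ z ∈ S, ∀ z' ∈ S, |φ' z - φ' z'| ≤ L * |z - z'|) (hB : ∀ z ∈ S, |φ' z| ≤ B) :
    HasQuadDeriv (fun r y => φ (g r y)) (fun y => φ' (g s y) * D y) T s := by
  obtain ⟨C, hC0, hC⟩ := hg
  obtain ⟨M, hM⟩ := hD
  refine ⟨L * (|M| + C * T) ^ 2 + |B| * C, by positivity, fun r hr y => ?_⟩
  have hT : |r - s| ≤ T := abs_sub_le_iff.2 ⟨by linarith [hr.2, hs.1], by linarith [hr.1, hs.2]⟩
  set δ := r - s
  have h1 := hC r hr y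
  set Δ := g r y - g s y with hΔ
  have h2 : |Δ| ≤ (|M| + C * T) * |δ| := by
    have e : Δ = (Δ - δ * D y) + δ * D y := by ring
    rw [e]
    refine (abs_add_le _ _).trans ?_
    rw [abs_mul δ]
    have a1 := mul_le_mul_of_nonneg_left ((hM y).trans (le_abs_self M)) (abs_nonneg δ)
    have a2 := mul_le_mul_of_nonneg_left (mul_le_mul_of_nonneg_right hT (abs_nonneg δ)) hC0
    nlinarith
  have h3 := taylor_one hS hL0 (fun z hz => (hφ z hz).hasDerivWithinAt)
    (fun z hz => hL z hz _ (hgS s hs y)) (hgS s hs y) (hgS r hr y)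
  rw [← hΔ] at h3
  have h4 : L * |Δ| ^ 2 ≤ L * ((|M| + C * T) * |δ|) ^ 2 :=
    mul_le_mul_of_nonneg_left (pow_le_pow_left₀ (abs_nonneg _) h2 2) hL0
  have h5 : |φ' (g s y) * (Δ - δ * D y)| ≤ |B| * (C * |δ| ^ 2) := by
    rw [abs_mul]
    exact mul_le_mul ((hB _ (hgS s hs y)).trans (le_abs_self B)) h1 (abs_nonneg _) (abs_nonneg _)
  have := (abs_add_le _ _).trans (add_le_add (h3.trans h4) h5)
  calc _ = _ := ?_
    _ ≤ _ := this
    _ = _ := by ring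
  congr 1
  ring

lemma HasQuadDeriv.log {F : Type*} {g : ℝ → F → ℝ} {D : F → ℝ} {T s m : ℝ}
    (hg : HasQuadDeriv g D T s) (hs : s ∈ Icc 0 T) (hD : ∃ M, ∀ y, |D y| ≤ M) (hm : 0 < m)
    (hgm : ∀ r ∈ Icc 0 T, ∀ y, m ≤ g r y) :
    HasQuadDeriv (fun r y => Real.log (g r y)) (fun y => (g s y)⁻¹ * D y) T s :=
  hg.comp hs hD (convex_Ici m) hgm (by positivity)
    (fun z hz => Real.hasDerivAt_log (hm.trans_le hz).ne')
    (fun z hz z' hz' => abs_inv_sub_inv_le hm hz' hz)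
    (fun z hz => by
      rw [abs_of_pos (inv_pos.2 (hm.trans_le hz))]
      exact inv_anti₀ hm hz)

lemma HasQuadDeriv.exp {F : Type*} {g : ℝ → F → ℝ} {D : F → ℝ} {T s M : ℝ}
    (hg : HasQuadDeriv g D T s) (hs : s ∈ Icc 0 T) (hD : ∃ M, ∀ y, |D y| ≤ M)
    (hgM : ∀ r ∈ Icc 0 T, ∀ y, g r y ≤ M) :
    HasQuadDeriv (fun r y => Real.exp (g r y)) (fun y => Real.exp (g s y) * D y) T s := by
  refine hg.comp hs hD (convex_Iic M) hgM (Real.exp_pos M).le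
    (fun z _ => Real.hasDerivAt_exp z) (fun z hz z' hz' => ?_) (B := Real.exp M)
    (fun z hz => by rw [abs_of_pos (Real.exp_pos z)]; exact Real.exp_le_exp.2 hz)
  have := abs_sub_le_of_abs_deriv_le (convex_Iic M) (a := z') 0 (Real.exp_pos M).le
    (fun x _ => (Real.hasDerivAt_exp x).hasDerivWithinAt) hz' hz
    (fun x hx => by
      rw [pow_zero, mul_one, abs_of_pos (Real.exp_pos x)]; exact Real.exp_le_exp.2 hx)
  simpa using this

lemma HasQuadDeriv.affine_mul {F : Type*} {g : ℝ → F → ℝ} {D : F → ℝ} {T s : ℝ}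
    (hg : HasQuadDeriv g D T s) (hD : ∃ M, ∀ y, |D y| ≤ M) (a b : ℝ) :
    HasQuadDeriv (fun r y => (a + b * r) * g r y) (fun y => b * g s y + (a + b * s) * D y) T s := by
  obtain ⟨C, hC0, hC⟩ := hg
  obtain ⟨M, hM⟩ := hD
  refine ⟨(|a| + |b| * |T|) * C + |b| * |M|, by positivity, fun r hr y => ?_⟩
  have h1 : |(a + b * r) * (g r y - g s y - (r - s) * D y)|
      ≤ (|a| + |b| * |T|) * (C * |r - s| ^ 2) := by
    rw [abs_mul]
    refine mul_le_mul ((abs_add_le _ _).trans ?_) (hC r hr y) (abs_nonneg _) (by positivity)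
    rw [abs_mul]
    have : |r| ≤ |T| := by rw [abs_of_nonneg hr.1]; exact hr.2.trans (le_abs_self T)
    linarith [mul_le_mul_of_nonneg_left this (abs_nonneg b)]
  -- The cross term between the increment of `a + b r` and that of `g`.
  have h2 : |b * D y * (r - s) ^ 2| ≤ |b| * |M| * |r - s| ^ 2 := by
    rw [abs_mul, abs_mul, abs_pow]
    exact mul_le_mul_of_nonneg_right (mul_le_mul_of_nonneg_left ((hM y).trans (le_abs_self M))
      (abs_nonneg b)) (by positivity)
  have := (abs_add_le _ _).trans (add_le_add h1 h2)
  calc _ = _ := ?_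
    _ ≤ _ := this
    _ = _ := by ring
  congr 1
  ring

/-- Positivity and mass one of `P` keep `P_{εt}(e^{-f/(2ε)})` between `e^{-C/(2ε)}` and
`e^{C/(2ε)}`. The bound is independent of `ε` and `t`, which makes the lower limit finite and the
exponentials integrable. -/
lemma IsDiffusion.abs_viscousHJ_le (h : P.IsDiffusion A) {f : E → ℝ} (hf : f ∈ A) {C : ℝ}
    (hC : ∀ x, |f x| ≤ C) {ε t : ℝ} (hε : 0 < ε) (ht : 0 ≤ t) (x : E) :
    |P.viscousHJ ε t f x| ≤ C := by
  have hG : (fun y => Real.exp (-f y / (2 * ε))) ∈ A := by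
    have := h.exp_mem hf (-1 / (2 * ε)) 0
    convert this using 3
    ring
  have hεt : 0 ≤ ε * t := mul_nonneg hε.le ht
  have h1 : Real.exp (-C / (2 * ε)) ≤ P.op (ε * t) (fun y => Real.exp (-f y / (2 * ε))) x :=
    h.le_op hG (fun y => Real.exp_le_exp.2 (div_le_div_of_nonneg_right
      (neg_le_neg (abs_le.1 (hC y)).2) (by positivity))) hεt x
  have h2 : P.op (ε * t) (fun y => Real.exp (-f y / (2 * ε))) x ≤ Real.exp (C / (2 * ε)) := by
    have := op_mono h hG (const_mem A (Real.exp (C / (2 * ε)))) hεt (fun y =>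
      Real.exp_le_exp.2 (div_le_div_of_nonneg_right (by linarith [(abs_le.1 (hC y)).1])
      (by positivity))) x
    rwa [op_const hεt] at this
  have hpos := (Real.exp_pos _).trans_le h1
  have l1 := (Real.le_log_iff_exp_le hpos).2 h1
  have l2 := (Real.log_le_iff_le_exp hpos).2 h2
  rw [div_le_iff₀ (by positivity)] at l1
  rw [le_div_iff₀ (by positivity)] at l2
  unfold viscousHJ
  rw [abs_le]
  constructor <;> nlinarith

/-- Hypercontractivity along the viscous Hamilton-Jacobi equation. -/
lemma IsDiffusion.viscous_hypercontractivity (h : P.IsDiffusion A) {ρ : ℝ}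
    (hLS : ∀ u, 0 < u → P.LocalLogSobolev A u (curvConst ρ u)) {ε u t q₂ : ℝ} (hε : 0 < ε)
    (hu : 0 < u) (ht : 0 < t) (hq₂ : 0 < q₂) {q' : ℝ}
    (hq' : q' = 1 / (2 * curvConst ρ (u + ε * t))) {f : E → ℝ} (hf : f ∈ A) (x : E) :
    (q₂ + q' * t)⁻¹ * Real.log (P.op u (fun y => Real.exp ((q₂ + q' * t) * P.viscousHJ ε t f y)) x)
      ≤ q₂⁻¹ * Real.log (P.op (u + ε * t) (fun y => Real.exp (q₂ * f y)) x) := by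
  have hcpos : 0 < curvConst ρ (u + ε * t) := curvConst_pos ρ (by positivity)
  have hq'0 : 0 < q' := by rw [hq']; positivity
  have hq'c : q' * curvConst ρ (u + ε * t) = 1 / 2 := by rw [hq']; field_simp
  obtain ⟨Cf, hCf⟩ := h.bounded f hf
  set a : ℝ := -1 / (2 * ε) with ha
  have haε : a * ε = -1 / 2 := by rw [ha]; field_simp
  set G : E → ℝ := fun y => Real.exp (-f y / (2 * ε)) with hG
  have hGe : G = fun y => Real.exp (a * f y) := by
    ext y; simp only [hG, ha]; congr 1; ring
  have hafA : (fun y => a * f y) ∈ A := A.smul_mem hf a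
  have hGA : G ∈ A := by rw [hGe]; exact h.exp_comp_mem hafA
  obtain ⟨m, hm, hGm⟩ := h.exists_pos_le_exp hafA
  replace hGm : ∀ y, m ≤ G y := fun y => by rw [hGe]; exact hGm y
  set g : ℝ → E → ℝ := fun r => P.op (ε * r) G with hg
  have hgA : ∀ r, 0 ≤ r → g r ∈ A := fun r hr => h.op_mem _ (mul_nonneg hε.le hr) G hGA
  have hgm : ∀ r, 0 ≤ r → ∀ y, m ≤ g r y := fun r hr y => h.le_op hGA hGm (mul_nonneg hε.le hr) y
  set v : ℝ → E → ℝ := fun r => P.viscousHJ ε r f with hv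
  have hvlog : ∀ r y, v r y = -2 * ε * Real.log (g r y) := fun r y => rfl
  have hvA : ∀ r, 0 ≤ r → v r ∈ A := fun r hr =>
    A.smul_mem (h.log_mem (hgA r hr) hm (hgm r hr)) (-2 * ε)
  have hgv : ∀ r, 0 ≤ r → g r = fun y => Real.exp (a * v r y + 0) := fun r hr => by
    ext y
    have e : a * (-2 * ε * Real.log (g r y)) + 0 = Real.log (g r y) := by
      linear_combination (-2 * Real.log (g r y)) * haε
    rw [hvlog, e, Real.exp_log (hm.trans_le (hgm r hr y))]
  have hLg : ∀ r, 0 ≤ r → ∀ y, (g r y)⁻¹ * P.gen (g r) y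
      = a * P.gen (v r) y + a ^ 2 * P.carreDuChamp (v r) (v r) y := fun r hr y => by
    have e := h.gen_exp (hvA r hr) a 0 y
    rw [← hgv r hr] at e
    have e2 : Real.exp (a * v r y + 0) = g r y := (congrFun (hgv r hr) y).symm
    rw [e, e2, inv_mul_cancel_left₀ (hm.trans_le (hgm r hr y)).ne']
  -- With this horizon `ε(T - s) = u + ε(t - s)`: at `s = t` the operator left to apply is exactly
  -- `P_u`.
  set T := t + u / ε with hT
  have hεT : ∀ s, ε * (T - s) = u + ε * (t - s) := fun s => by rw [hT]; field_simp; ring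
  have htT : t ≤ T := by rw [hT]; have := div_pos hu hε; linarith
  set q : ℝ → ℝ := fun s => q₂ + q' * s with hqdef
  have hqpos : ∀ s, 0 ≤ s → 0 < q s := fun s hs => by simp only [hqdef]; positivity
  set F : ℝ → E → ℝ := fun s y => Real.exp (q s * v s y) with hF
  have hqvA : ∀ s, 0 ≤ s → (fun y => q s * v s y) ∈ A := fun s hs => A.smul_mem (hvA s hs) (q s)
  have hFA : ∀ s, 0 ≤ s → F s ∈ A := fun s hs => h.exp_comp_mem (hqvA s hs)
  -- the time derivative of `F`
  have hFd : ∀ s ∈ Icc 0 t, HasQuadDeriv F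
      (F s * (q' • v s + q s • (ε • P.gen (v s) - (2⁻¹ : ℝ) • P.carreDuChamp (v s) (v s)))) T s := by
    intro s hs
    have hsT : s ∈ Icc 0 T := ⟨hs.1, hs.2.trans htT⟩
    have hvs := hvA s hs.1
    obtain ⟨C, hC0, hC⟩ := h.exists_op_taylor_one hGA
    have d1 : HasQuadDeriv g (ε • P.gen (g s)) T s := by
      refine ⟨C * ε ^ 2, by positivity, fun r hr y => ?_⟩
      have := hC (ε * s) (ε * r) (mul_nonneg hε.le hs.1) (mul_nonneg hε.le hr.1) y
      rw [← mul_sub, abs_mul, abs_of_pos hε, ← h.gen_op hGA (mul_nonneg hε.le hs.1)] at this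
      simp only [Pi.smul_apply, smul_eq_mul]
      convert this using 1
      · congr 1; ring
      · ring
    have hgen := h.gen_mem _ (hgA s hs.1)
    have d2 := d1.log hsT (h.bounded _ (A.smul_mem hgen ε)) hm fun r hr => hgm r hr.1
    have e2 : (fun y => (g s y)⁻¹ * (ε • P.gen (g s)) y)
        = ε • (a • P.gen (v s) + a ^ 2 • P.carreDuChamp (v s) (v s)) := by
      ext y
      simp only [Pi.smul_apply, smul_eq_mul, Pi.add_apply]
      rw [← hLg s hs.1 y]
      ring
    rw [e2] at d2
    have hΓ := h.carreDuChamp_mem hvs hvs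
    have hgv' := h.gen_mem _ hvs
    have d3 := d2.affine_mul (h.bounded _ (A.smul_mem (A.add_mem (A.smul_mem hgv' _)
      (A.smul_mem hΓ _)) _)) (q₂ * (-2 * ε)) (q' * (-2 * ε))
    -- The viscous equation `∂_s v = εLv - Γ(v)/2`, multiplied by `q` and completed by the term
    -- `q'v`.
    have e3 : (fun y => q' * (-2 * ε) * Real.log (g s y) + (q₂ * (-2 * ε) + q' * (-2 * ε) * s) *
        (ε • (a • P.gen (v s) + a ^ 2 • P.carreDuChamp (v s) (v s))) y)
        = q' • v s + q s • (ε • P.gen (v s) - (2⁻¹ : ℝ) • P.carreDuChamp (v s) (v s)) := by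
      ext y
      simp only [Pi.smul_apply, smul_eq_mul, Pi.add_apply, Pi.sub_apply, hvlog, hqdef]
      linear_combination (-2 * (q₂ + q' * s) * (ε * P.gen (v s) y)
        - 2 * (q₂ + q' * s) * P.carreDuChamp (v s) (v s) y * (a * ε - 1 / 2)) * haε
    have e3' : (fun (r : ℝ) y => (q₂ * (-2 * ε) + q' * (-2 * ε) * r) * Real.log (g r y))
        = fun r y => q r * v r y := by
      ext r y
      simp only [hvlog, hqdef]
      ring
    rw [e3, e3'] at d3
    refine d3.exp (M := q T * Cf) hsT (h.bounded _ ?_) fun r hr y => ?_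
    · exact A.add_mem (A.smul_mem hvs _) (A.smul_mem (A.sub_mem (A.smul_mem hgv' _)
        (A.smul_mem hΓ _)) _)
    · have b1 : v r y ≤ Cf := (le_abs_self _).trans (h.abs_viscousHJ_le hf hCf hε hr.1 y)
      have b2 : 0 ≤ Cf := (abs_nonneg _).trans (hCf y)
      have b3 : q r ≤ q T := by
        simp only [hqdef]; linarith [mul_le_mul_of_nonneg_left hr.2 hq'0.le]
      exact (mul_le_mul_of_nonneg_left b1 (hqpos r hr.1).le).trans
        (mul_le_mul_of_nonneg_right b3 b2)
  set U : ℝ → ℝ := fun s => P.op (ε * (T - s)) (F s) x with hU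
  have hUpos : ∀ s ∈ Icc 0 t, 0 < U s := by
    intro s hs
    have hτ : 0 ≤ ε * (T - s) := mul_nonneg hε.le (by linarith [hs.2])
    obtain ⟨m', hm', hFm⟩ := h.exists_pos_le_exp (hqvA s hs.1)
    exact hm'.trans_le (h.le_op (hFA s hs.1) hFm hτ x)
  -- `q U' ≤ q' U log U` says that `U^{1/q}` has nonpositive logarithmic derivative.
  have hUd : ∀ s ∈ Icc 0 t, ∃ d, HasDerivWithinAt U d (Icc 0 t) s ∧
      q s * d ≤ q' * (U s * Real.log (U s)) := by
    intro s hs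
    have hsT : s ∈ Icc 0 T := ⟨hs.1, hs.2.trans htT⟩
    have hvs := hvA s hs.1
    have hFs := hFA s hs.1
    have hΓ := h.carreDuChamp_mem hvs hvs
    have hgv' := h.gen_mem _ hvs
    have hDA := A.mul_mem hFs (A.add_mem (A.smul_mem hvs q') (A.smul_mem (A.sub_mem
      (A.smul_mem hgv' ε) (A.smul_mem hΓ (2⁻¹ : ℝ))) (q s)))
    have hfl := (h.hasDerivWithinAt_flow hε.le (fun r hr => hFA r hr.1) hDA hsT
      (fun η hη => (hFd s hs).eventually_le hη) x).mono (Icc_subset_Icc_right htT)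
    refine ⟨_, hfl, ?_⟩
    set τ := ε * (T - s) with hτdef
    have hτu : τ = u + ε * (t - s) := hεT s
    have hτ0 : 0 < τ := by
      rw [hτu]; have := mul_nonneg hε.le (sub_nonneg.2 hs.2); linarith
    -- `q'` is tuned to the longest time `u + εt`; as `c` is increasing, `q' c(τ) ≤ 1/2` at all the
    -- times used.
    have hτle : curvConst ρ τ ≤ curvConst ρ (u + ε * t) := by
      refine (strictMono_curvConst ρ).monotone ?_
      rw [hτu]; linarith [mul_nonneg hε.le hs.1]
    have hls := hLS τ hτ0 _ (hqvA s hs.1) x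
    have hsq : (fun y => q s * v s y) = q s • v s := rfl
    have hFΓ := A.mul_mem hFs hΓ
    have hvF := A.mul_mem hvs hFs
    have e1 : P.op τ ((fun y => q s * v s y) * F s) x = q s * P.op τ (v s * F s) x := by
      rw [← op_const_mul]; congr 1; ext y; simp [mul_assoc]
    have e2 : P.op τ (F s * P.carreDuChamp (fun y => q s * v s y) (fun y => q s * v s y)) x
        = q s ^ 2 * P.op τ (F s * P.carreDuChamp (v s) (v s)) x := by
      rw [hsq, h.carreDuChamp_smul_left hvs (A.smul_mem hvs _), h.carreDuChamp_smul_right hvs hvs,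
        ← op_const_mul]
      congr 1; ext y; simp; ring
    have e3 : ε * P.op τ (P.gen (F s)) x = P.op τ (ε • P.gen (F s)) x :=
      (op_const_mul ε _ τ x).symm
    have hLF : P.gen (F s)
        = F s * (q s • P.gen (v s) + q s ^ 2 • P.carreDuChamp (v s) (v s)) := by
      ext y
      have := h.gen_exp hvs (q s) 0 y
      simp only [add_zero] at this
      exact this
    -- In `∂_s F - εLF` the terms in `Lv` cancel, leaving `q'vF` and a negative multiple of `FΓ(v)`.
    -- Its part `-q/2` absorbs the log Sobolev energy; the part `-εq²` is discarded.
    have e4 : P.op τ (F s * (q' • v s + q s • (ε • P.gen (v s)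
        - (2⁻¹ : ℝ) • P.carreDuChamp (v s) (v s)))) x - ε * P.op τ (P.gen (F s)) x
        = q' * P.op τ (v s * F s) x
          - (q s / 2 + ε * q s ^ 2) * P.op τ (F s * P.carreDuChamp (v s) (v s)) x := by
      rw [e3, ← h.op_sub hDA (A.smul_mem (h.gen_mem _ hFs) ε) hτ0.le, ← op_const_mul q',
        ← op_const_mul (q s / 2 + ε * q s ^ 2)]
      have := h.op_sub (A.smul_mem hvF q') (A.smul_mem hFΓ (q s / 2 + ε * q s ^ 2)) hτ0.le x
      refine Eq.trans ?_ this
      congr 1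
      ext y
      simp only [hLF, Pi.smul_apply, smul_eq_mul, Pi.add_apply, Pi.sub_apply, Pi.mul_apply]
      ring
    rw [e4]
    change P.op τ ((fun y => q s * v s y) * F s) x - U s * Real.log (U s)
      ≤ curvConst ρ τ * P.op τ (F s * P.carreDuChamp (fun y => q s * v s y)
        (fun y => q s * v s y)) x at hls
    rw [e1, e2] at hls
    set I := P.op τ (F s * P.carreDuChamp (v s) (v s)) x
    have hI : 0 ≤ I := integral_nonneg fun y =>
      mul_nonneg (Real.exp_pos _).le (h.carreDuChamp_self_nonneg hvs y)
    have hqs := hqpos s hs.1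
    have h1 := mul_le_mul_of_nonneg_left hls hq'0.le
    have h2 : q' * curvConst ρ τ * (q s ^ 2 * I) ≤ 1 / 2 * (q s ^ 2 * I) := by
      refine mul_le_mul_of_nonneg_right ?_ (by positivity)
      rw [← hq'c]
      exact mul_le_mul_of_nonneg_left hτle hq'0.le
    have h3 : 0 ≤ ε * q s ^ 3 * I := by positivity
    linarith
  choose! d hd hdle using hUd
  have hHd : ∀ s ∈ Icc 0 t, HasDerivWithinAt (fun s => (q s)⁻¹ * Real.log (U s))
      (-q' / q s ^ 2 * Real.log (U s) + (q s)⁻¹ * (d s / U s)) (Icc 0 t) s := by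
    intro s hs
    have hq : HasDerivWithinAt q q' (Icc 0 t) s := by
      have := ((hasDerivAt_id' s).const_mul q').const_add q₂
      rw [mul_one] at this
      exact this.hasDerivWithinAt
    exact (hq.inv (hqpos s hs.1).ne').mul ((hd s hs).log (hUpos s hs).ne')
  have hsub : interior (Icc 0 t) ⊆ Icc 0 t := interior_subset
  have hanti := antitoneOn_of_hasDerivWithinAt_nonpos (convex_Icc 0 t)
    (fun s hs => (hHd s hs).continuousWithinAt) (fun s hs => (hHd s (hsub hs)).mono hsub)
    (fun s hs => ?_)
  · have := hanti ⟨le_rfl, ht.le⟩ ⟨ht.le, le_rfl⟩ ht.le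
    have e0 : v 0 = f := by
      ext y
      have : g 0 y = Real.exp (a * f y) := by
        simp only [hg, mul_zero]; rw [op_zero (h.measurable G hGA), hGe]
      rw [hvlog, this, Real.log_exp]
      linear_combination (-2 * f y) * haε
    simp only [hU, hεT, hF, e0, hqdef, sub_self, mul_zero, add_zero, sub_zero] at this
    exact this
  · have hs' := hsub hs
    have hqs := hqpos s hs'.1
    have hUs := hUpos s hs'
    have e : -q' / q s ^ 2 * Real.log (U s) + (q s)⁻¹ * (d s / U s)
        = (q s * d s - q' * (U s * Real.log (U s))) / (q s ^ 2 * U s) := by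
      field_simp
      ring
    rw [e]
    exact div_nonpos_of_nonpos_of_nonneg (sub_nonpos.2 (hdle s hs')) (by positivity)

end Hypercontractivity

end MarkovSemigroup

namespace MarkovSemigroup

variable {E : Type*} [MeasurableSpace E] {P : MarkovSemigroup E} {A : Subalgebra ℝ (E → ℝ)}

/-! ### Vanishing viscosity limit and the return to the logarithmic Sobolev inequality. -/

section HamiltonJacobi

/-- A real `liminf` is a supremum with a default value on unbounded sets; the uniform bound on `v^ε`
rules that case out. -/
lemma IsDiffusion.le_hamiltonJacobi (h : P.IsDiffusion A) {f : E → ℝ} (hf : f ∈ A) {t : ℝ}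
    (ht : 0 ≤ t) {x : E} {a : ℝ} (ha : ∀ᶠ ε in 𝓝[>] (0 : ℝ), a ≤ P.viscousHJ ε t f x) :
    a ≤ P.hamiltonJacobi t f x := by
  obtain ⟨C, hC⟩ := h.bounded f hf
  refine le_liminf_of_le (IsBoundedUnder.isCoboundedUnder_ge ⟨C, ?_⟩) ha
  rw [eventually_map]
  filter_upwards [self_mem_nhdsWithin] with ε hε
  exact (le_abs_self _).trans (h.abs_viscousHJ_le hf hC hε ht x)

lemma IsDiffusion.isBoundedUnder_viscousHJ (h : P.IsDiffusion A) {f : E → ℝ} (hf : f ∈ A) {t : ℝ}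
    (ht : 0 ≤ t) (x : E) :
    IsBoundedUnder (· ≥ ·) (𝓝[>] (0 : ℝ)) fun ε => P.viscousHJ ε t f x := by
  obtain ⟨C, hC⟩ := h.bounded f hf
  refine ⟨-C, ?_⟩
  rw [eventually_map]
  filter_upwards [self_mem_nhdsWithin] with ε hε
  exact (abs_le.1 (h.abs_viscousHJ_le hf hC hε ht x)).1

lemma IsDiffusion.abs_hamiltonJacobi_le (h : P.IsDiffusion A) {f : E → ℝ} (hf : f ∈ A) {C : ℝ}
    (hC : ∀ x, |f x| ≤ C) {t : ℝ} (ht : 0 ≤ t) (x : E) : |P.hamiltonJacobi t f x| ≤ C := by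
  refine abs_le.2 ⟨h.le_hamiltonJacobi hf ht ?_, ?_⟩
  · filter_upwards [self_mem_nhdsWithin] with ε hε
    exact (abs_le.1 (h.abs_viscousHJ_le hf hC hε ht x)).1
  · refine liminf_le_of_le (h.isBoundedUnder_viscousHJ hf ht x) fun b hb => ?_
    obtain ⟨ε, hbε, hε⟩ := (hb.and self_mem_nhdsWithin).exists
    exact hbε.trans ((le_abs_self _).trans (h.abs_viscousHJ_le hf hC hε ht x))

lemma IsDiffusion.integrable_exp_hamiltonJacobi (h : P.IsDiffusion A) {f : E → ℝ} (hf : f ∈ A)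
    {t u : ℝ} (ht : 0 ≤ t) (hu : 0 ≤ u) (q : ℝ) (x : E) :
    Integrable (fun y => Real.exp (q * P.hamiltonJacobi t f y)) (P.kernel u x) := by
  obtain ⟨C, hC⟩ := h.bounded f hf
  have := P.isMarkov u hu
  have hQm := h.measurable_hamiltonJacobi hf ht
  refine Integrable.of_bound (by fun_prop) (Real.exp (|q| * C)) (ae_of_all _ fun y => ?_)
  rw [Real.norm_eq_abs, Real.abs_exp, Real.exp_le_exp]
  refine (le_abs_self _).trans ?_
  rw [abs_mul]
  exact mul_le_mul_of_nonneg_left (h.abs_hamiltonJacobi_le hf hC ht y) (abs_nonneg q)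

/-- Hypercontractivity of the Hamilton-Jacobi semigroup. -/
theorem IsDiffusion.hypercontractivity (h : P.IsDiffusion A) {ρ : ℝ}
    (hLS : ∀ u, 0 < u → P.LocalLogSobolev A u (curvConst ρ u)) {q₁ q₂ u t : ℝ} (hu : 0 < u)
    (ht : 0 < t) (hq₂ : 0 < q₂) (hq₁ : q₁ = q₂ + t / (2 * curvConst ρ u)) {f : E → ℝ} (hf : f ∈ A)
    (x : E) :
    (P.op u (fun y => Real.exp (q₁ * P.hamiltonJacobi t f y)) x) ^ (1 / q₁) ≤
      (P.op u (fun y => Real.exp (q₂ * f y)) x) ^ (1 / q₂) := by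
  have hM := P.isMarkov u hu.le
  have hc0 := curvConst_pos ρ hu
  have hq₁0 : 0 < q₁ := by rw [hq₁]; positivity
  -- Fatou's lemma needs a sequence of viscosities. Passing to one can only raise the lower limit,
  -- which is the favourable direction.
  set e : ℕ → ℝ := fun n => 1 / ((n : ℝ) + 1) with he
  have he0 : ∀ n, 0 < e n := fun n => by simp only [he]; positivity
  have helim : Tendsto e atTop (𝓝 0) := tendsto_one_div_add_atTop_nhds_zero_nat
  have helim' : Tendsto e atTop (𝓝[>] 0) :=
    tendsto_nhdsWithin_iff.2 ⟨helim, Eventually.of_forall he0⟩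
  set q : ℕ → ℝ := fun n => q₂ + 1 / (2 * curvConst ρ (u + e n * t)) * t with hq
  have hqpos : ∀ n, 0 < q n := fun n => by
    have := curvConst_pos ρ (u := u + e n * t) (by have := he0 n; positivity)
    simp only [hq]; positivity
  have hulim : Tendsto (fun n => u + e n * t) atTop (𝓝 u) := by
    simpa using (helim.mul_const t).const_add u
  have hqlim : Tendsto q atTop (𝓝 q₁) := by
    have h1 : Tendsto (fun n => curvConst ρ (u + e n * t)) atTop (𝓝 (curvConst ρ u)) :=
      ((continuous_curvConst ρ).tendsto u).comp hulim
    have h2 := ((tendsto_const_nhds (x := (1 : ℝ))).div (h1.const_mul 2)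
      (by positivity)).mul_const t
    have h3 := h2.const_add q₂
    have e1 : q₂ + 1 / (2 * curvConst ρ u) * t = q₁ := by rw [hq₁]; ring
    rwa [e1] at h3
  have hq₂f : (fun y => q₂ * f y) ∈ A := A.smul_mem hf q₂
  have hGA := h.exp_comp_mem hq₂f
  obtain ⟨m, hm, hGm⟩ := h.exists_pos_le_exp hq₂f
  set V : ℝ → ℝ := fun s => P.op s (fun y => Real.exp (q₂ * f y)) x with hV
  have hVpos : ∀ s, 0 ≤ s → 0 < V s := fun s hs => hm.trans_le (h.le_op hGA hGm hs x)
  have hVlim : Tendsto (fun n => V (u + e n * t)) atTop (𝓝 (V u)) := by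
    refine ((h.continuousOn hGA x) u hu.le).tendsto.comp (tendsto_nhdsWithin_iff.2 ⟨hulim, ?_⟩)
    exact Eventually.of_forall fun n => by have := he0 n; simp only [mem_Ici]; positivity
  have hBlim : Tendsto (fun n => Real.exp (q n * (q₂⁻¹ * Real.log (V (u + e n * t))))) atTop
      (𝓝 (Real.exp (q₁ * (q₂⁻¹ * Real.log (V u))))) :=
    (Real.continuous_exp.tendsto _).comp
      (hqlim.mul ((hVlim.log (hVpos u hu.le).ne').const_mul _))
  set v : ℕ → E → ℝ := fun n => P.viscousHJ (e n) t f with hv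
  obtain ⟨C, hC⟩ := h.bounded f hf
  have hvm : ∀ n, Measurable (v n) := fun n => by
    have hg : Measurable fun y => Real.exp (-f y / (2 * e n)) := by
      have := h.measurable f hf
      fun_prop
    have : Measurable fun x => ∫ y, Real.exp (-f y / (2 * e n)) ∂(P.kernel (e n * t) x) :=
      (hg.stronglyMeasurable.integral_kernel (κ := P.kernel (e n * t))).measurable
    exact (this.log).const_mul _
  have hint : ∀ n, Integrable (fun y => Real.exp (q n * v n y)) (P.kernel u x) := fun n => by
    have := hvm n
    refine Integrable.of_bound (by fun_prop) (Real.exp (q n * C)) (ae_of_all _ fun y => ?_)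
    rw [Real.norm_eq_abs, Real.abs_exp, Real.exp_le_exp]
    exact mul_le_mul_of_nonneg_left ((le_abs_self _).trans
      (h.abs_viscousHJ_le hf hC (he0 n) ht.le y)) (hqpos n).le
  have hbound : ∀ n, ∫ y, Real.exp (q n * v n y) ∂(P.kernel u x)
      ≤ Real.exp (q n * (q₂⁻¹ * Real.log (V (u + e n * t)))) := fun n => by
    have := h.viscous_hypercontractivity hLS (he0 n) hu ht hq₂ rfl hf x
    rw [inv_mul_le_iff₀ (hqpos n)] at this
    exact (Real.log_le_iff_le_exp (integral_exp_pos (hint n))).1 this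
  have hpt : ∀ y, ENNReal.ofReal (Real.exp (q₁ * P.hamiltonJacobi t f y))
      ≤ liminf (fun n => ENNReal.ofReal (Real.exp (q n * v n y))) atTop := by
    intro y
    set Q := P.hamiltonJacobi t f y with hQ
    -- The margin `η` gives the strict inequality `Q - η < v n y` eventually and a fixed number
    -- against which the moving exponents `q n` converge.
    have hη : ∀ η, 0 < η → ENNReal.ofReal (Real.exp (q₁ * (Q - η)))
        ≤ liminf (fun n => ENNReal.ofReal (Real.exp (q n * v n y))) atTop := by
      intro η hη
      have h1 : ∀ᶠ n in atTop, Q - η < v n y :=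
        helim'.eventually (eventually_lt_of_lt_liminf (b := Q - η) (by
          change Q - η < Q; linarith) (h.isBoundedUnder_viscousHJ hf ht.le y))
      have h2 : Tendsto (fun n => ENNReal.ofReal (Real.exp (q n * (Q - η)))) atTop
          (𝓝 (ENNReal.ofReal (Real.exp (q₁ * (Q - η))))) :=
        ENNReal.tendsto_ofReal ((Real.continuous_exp.tendsto _).comp (hqlim.mul_const _))
      rw [← h2.liminf_eq]
      refine liminf_le_liminf ?_
      filter_upwards [h1] with n hn
      exact ENNReal.ofReal_le_ofReal (Real.exp_le_exp.2
        (mul_le_mul_of_nonneg_left hn.le (hqpos n).le))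
    have hlim : Tendsto (fun η => ENNReal.ofReal (Real.exp (q₁ * (Q - η)))) (𝓝[>] 0)
        (𝓝 (ENNReal.ofReal (Real.exp (q₁ * Q)))) := by
      have hc : Continuous fun η => ENNReal.ofReal (Real.exp (q₁ * (Q - η))) :=
        ENNReal.continuous_ofReal.comp (by fun_prop)
      have := hc.tendsto 0
      rw [sub_zero] at this
      exact this.mono_left nhdsWithin_le_nhds
    refine le_of_tendsto hlim ?_
    filter_upwards [self_mem_nhdsWithin] with η hη0 using hη η hη0
  have hmain : P.op u (fun y => Real.exp (q₁ * P.hamiltonJacobi t f y)) x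
      ≤ Real.exp (q₁ * (q₂⁻¹ * Real.log (V u))) := by
    rw [← ENNReal.ofReal_le_ofReal_iff (Real.exp_pos _).le]
    have hi := h.integrable_exp_hamiltonJacobi hf ht.le hu.le q₁ x
    unfold op
    rw [ofReal_integral_eq_lintegral_ofReal hi (ae_of_all _ fun y => (Real.exp_pos _).le)]
    calc _ ≤ ∫⁻ y, liminf (fun n => ENNReal.ofReal (Real.exp (q n * v n y))) atTop
          ∂(P.kernel u x) := lintegral_mono hpt
      _ ≤ liminf (fun n => ∫⁻ y, ENNReal.ofReal (Real.exp (q n * v n y)) ∂(P.kernel u x)) atTop :=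
        lintegral_liminf_le fun n => by have := hvm n; fun_prop
      _ ≤ liminf (fun n => ENNReal.ofReal
          (Real.exp (q n * (q₂⁻¹ * Real.log (V (u + e n * t)))))) atTop := by
        refine liminf_le_liminf (Eventually.of_forall fun n => ?_)
        rw [← ofReal_integral_eq_lintegral_ofReal (hint n)
          (ae_of_all _ fun y => (Real.exp_pos _).le)]
        exact ENNReal.ofReal_le_ofReal (hbound n)
      _ = _ := (ENNReal.tendsto_ofReal hBlim).liminf_eq
  have hnn : 0 ≤ P.op u (fun y => Real.exp (q₁ * P.hamiltonJacobi t f y)) x :=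
    integral_nonneg fun y => (Real.exp_pos _).le
  refine (Real.rpow_le_rpow hnn hmain (by positivity)).trans (le_of_eq ?_)
  change _ = V u ^ (1 / q₂)
  rw [← Real.exp_mul, Real.rpow_def_of_pos (hVpos u hu.le)]
  congr 1
  field_simp

/-- A lower bound for the Hamilton-Jacobi semigroup for small times, by means of an explicit
subsolution of the viscous equation. -/
lemma IsDiffusion.exists_le_hamiltonJacobi (h : P.IsDiffusion A) {f : E → ℝ} (hf : f ∈ A) :
    ∃ K, 0 ≤ K ∧ ∀ t ∈ Icc (0 : ℝ) 1, ∀ x,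
      f x - t / 2 * P.carreDuChamp f f x - K * t ^ 2 ≤ P.hamiltonJacobi t f x := by
  set G := P.carreDuChamp f f with hG
  have hGA : G ∈ A := h.carreDuChamp_mem hf hf
  obtain ⟨M₁, hM₁⟩ := h.bounded _ (h.carreDuChamp_mem hf hGA)
  obtain ⟨M₂, hM₂⟩ := h.bounded _ (h.carreDuChamp_mem hGA hGA)
  obtain ⟨M₃, hM₃⟩ := h.bounded _ (h.gen_mem f hf)
  obtain ⟨M₄, hM₄⟩ := h.bounded _ (h.gen_mem G hGA)
  obtain ⟨B, hB⟩ := h.bounded f hf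
  obtain ⟨B', hB'⟩ := h.bounded G hGA
  -- `K` will absorb `Γ(f, Γ(f))` and `Γ(Γ(f))`, and `C` will absorb the viscous term `εL(f -
  -- (s/2)Γ(f))`, for `s ≤ 1`.
  set K := |M₁| + |M₂| with hK
  set C := |M₃| + |M₄| with hC
  have hK0 : 0 ≤ K := by positivity
  have hC0 : 0 ≤ C := by positivity
  have hvis : ∀ ε, 0 < ε → ∀ t ∈ Icc (0 : ℝ) 1, ∀ x,
      f x - t / 2 * G x - K * t ^ 2 - ε * C * t ≤ P.viscousHJ ε t f x := by
    intro ε hε t ht x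
    set a : ℝ := -1 / (2 * ε) with ha
    have ha0 : a < 0 := div_neg_of_neg_of_pos (by norm_num) (by positivity)
    have haε : a * ε = -1 / 2 := by rw [ha]; field_simp
    -- `a w_s + b s = a (f - (s/2)G - Ks² - εCs)`: the candidate subsolution after the Hopf–Cole
    -- change of variables.
    set b : ℝ → ℝ := fun s => -a * (K * s ^ 2 + ε * C * s) with hb
    set w : ℝ → E → ℝ := fun s => f + (-s / 2) • G with hw
    have hwA : ∀ s, w s ∈ A := fun s => A.add_mem hf (A.smul_mem hGA _)
    set F : ℝ → E → ℝ := fun s y => Real.exp (a * w s y + b s) with hF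
    have hFA : ∀ s, F s ∈ A := fun s => h.exp_mem (hwA s) a (b s)
    set D : ℝ → E → ℝ := fun s => a • ((-1 / 2 : ℝ) • G - fun _ => 2 * K * s + ε * C) with hD
    have hDA : ∀ s, D s ∈ A := fun s =>
      A.smul_mem (A.sub_mem (A.smul_mem hGA _) (const_mem A _)) a
    have hFd : ∀ s ∈ Icc 0 t, HasQuadDeriv F (F s * D s) t s := by
      intro s hs
      have d1 : HasQuadDeriv (fun r y => a * w r y + b r) (D s) t s := by
        refine ⟨|a| * K, by positivity, fun r hr y => le_of_eq ?_⟩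
        have e1 : a * w r y + b r - (a * w s y + b s) - (r - s) * D s y
            = -a * K * (r - s) ^ 2 := by
          simp only [hw, hb, hD, Pi.add_apply, Pi.smul_apply, Pi.sub_apply, smul_eq_mul]
          ring
        rw [e1, abs_mul, abs_mul, abs_neg, abs_of_nonneg hK0, abs_pow]
      refine d1.exp (M := |a| * (B + t * B') + |a| * (K * t ^ 2 + ε * C * t)) hs
        (h.bounded _ (hDA s)) fun r hr y => add_le_add ?_ ?_
      · refine (le_abs_self _).trans ?_
        rw [abs_mul]
        refine mul_le_mul_of_nonneg_left ((abs_add_le _ _).trans (add_le_add (hB y) ?_))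
          (abs_nonneg a)
        rw [Pi.smul_apply, smul_eq_mul, abs_mul]
        refine mul_le_mul ?_ (hB' y) (abs_nonneg _) ht.1
        rw [abs_div, abs_neg, abs_of_nonneg hr.1, abs_two]
        linarith [hr.1, hr.2]
      · simp only [hb]
        rw [abs_of_neg ha0]
        refine mul_le_mul_of_nonneg_left ?_ (neg_nonneg.2 ha0.le)
        have := pow_le_pow_left₀ hr.1 hr.2 2
        have h1 := mul_le_mul_of_nonneg_left this hK0
        have h2 := mul_le_mul_of_nonneg_left hr.2 (mul_nonneg hε.le hC0)
        linarith
    have key : ∀ s ∈ Icc 0 t, HasDerivWithinAt (fun r => P.op (ε * (t - r)) (F r) x)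
        (P.op (ε * (t - s)) (F s * D s - ε • P.gen (F s)) x) (Icc 0 t) s := by
      intro s hs
      have hFD := A.mul_mem (hFA s) (hDA s)
      have := h.hasDerivWithinAt_flow hε.le (fun r _ => hFA r) hFD hs
        (fun η hη => (hFd s hs).eventually_le hη) x
      rw [← op_const_mul] at this
      have e1 := h.op_sub hFD (A.smul_mem (h.gen_mem _ (hFA s)) ε)
        (mul_nonneg hε.le (sub_nonneg.2 hs.2)) x
      rw [e1]
      exact this
    have hsub : interior (Icc 0 t) ⊆ Icc 0 t := interior_subset
    -- Monotonicity of `s ↦ P_{ε(t-s)} F_s` gives `P_{εt}(e^{-f/(2ε)}) ≤ F_t`, and `-2ε log`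
    -- reverses it into the lower bound.
    have hmono := monotoneOn_of_hasDerivWithinAt_nonneg (convex_Icc 0 t)
      (fun s hs => (key s hs).continuousWithinAt) (fun s hs => (key s (hsub hs)).mono hsub)
      (fun s hs => ?_)
    · have h1 := hmono ⟨le_rfl, ht.1⟩ ⟨ht.1, le_rfl⟩ ht.1
      beta_reduce at h1
      have e0 : F 0 = fun y => Real.exp (-f y / (2 * ε)) := by
        ext y
        simp only [hF, hw, hb, ha, Pi.add_apply, Pi.smul_apply, smul_eq_mul]
        congr 1
        ring
      rw [sub_zero, sub_self, mul_zero, e0, op_zero (h.measurable _ (hFA t))] at h1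
      have hpos : 0 < P.op (ε * t) (fun y => Real.exp (-f y / (2 * ε))) x := by
        rw [← e0]
        have := P.isMarkov (ε * t) (mul_nonneg hε.le ht.1)
        exact integral_exp_pos (h.integrable (hFA 0) (mul_nonneg hε.le ht.1) x)
      have h2 := (Real.log_le_iff_le_exp hpos).2 h1
      have h3 := mul_le_mul_of_nonneg_left h2 (by positivity : 0 ≤ 2 * ε)
      have e2 : 2 * ε * (a * w t x + b t) = -(f x - t / 2 * G x - K * t ^ 2 - ε * C * t) := by
        simp only [hw, hb, Pi.add_apply, Pi.smul_apply, smul_eq_mul]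
        linear_combination (2 * (f x + -t / 2 * G x - (K * t ^ 2 + ε * C * t))) * haε
      rw [e2] at h3
      unfold viscousHJ
      linarith
    · refine integral_nonneg fun y => ?_
      have hs' := hsub hs
      have hs1 : s ≤ 1 := hs'.2.trans ht.2
      have hs0 := hs'.1
      have hsG := A.smul_mem hGA (-s / 2)
      have eL : P.gen (w s) y = P.gen f y + -s / 2 * P.gen G y := by
        simp only [hw]
        rw [h.gen_add hf hsG, h.gen_smul hGA]; rfl
      have eΓ : P.carreDuChamp (w s) (w s) y
          = G y - s * P.carreDuChamp f G y + s ^ 2 / 4 * P.carreDuChamp G G y := by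
        simp only [hw]
        rw [h.carreDuChamp_add_left hf hsG (hwA s), h.carreDuChamp_add_right hf hsG hf,
          h.carreDuChamp_add_right hf hsG hsG, h.carreDuChamp_smul_left hGA hf,
          h.carreDuChamp_smul_left hGA hsG, h.carreDuChamp_smul_right hGA hGA,
          h.carreDuChamp_smul_right hGA hf, carreDuChamp_comm G f]
        simp only [Pi.add_apply, Pi.smul_apply, smul_eq_mul, ← hG]
        ring
      have e3 : (F s * D s - ε • P.gen (F s)) y = F s y * (-a) * (2 * K * s + ε * C
          + s / 2 * P.carreDuChamp f G y - s ^ 2 / 8 * P.carreDuChamp G G y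
          + ε * (P.gen f y - s / 2 * P.gen G y)) := by
        have := h.gen_exp (hwA s) a (b s) y
        simp only [Pi.sub_apply, Pi.mul_apply, Pi.smul_apply, smul_eq_mul]
        change F s y * D s y - ε * P.gen (fun y => Real.exp (a * w s y + b s)) y = _
        rw [this, eL, eΓ]
        simp only [hD, hF, Pi.sub_apply, Pi.smul_apply, smul_eq_mul]
        linear_combination (-a * Real.exp (a * w s y + b s) * (G y - s * P.carreDuChamp f G y
          + s ^ 2 / 4 * P.carreDuChamp G G y)) * haε
      rw [e3]
      refine mul_nonneg (mul_nonneg (Real.exp_pos _).le (neg_nonneg.2 ha0.le)) ?_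
      have c1 := (abs_le.1 ((hM₁ y).trans (le_abs_self M₁))).1
      have c2 := (abs_le.1 ((hM₂ y).trans (le_abs_self M₂))).2
      have c3 := (abs_le.1 ((hM₃ y).trans (le_abs_self M₃))).1
      have c4 := (abs_le.1 ((hM₄ y).trans (le_abs_self M₄))).2
      have hss : s ^ 2 ≤ s := by nlinarith
      have i1 := mul_le_mul_of_nonneg_left c1 hs0
      have i2 := mul_le_mul_of_nonneg_left c2 (sq_nonneg s)
      have i2' := mul_le_mul_of_nonneg_right hss (abs_nonneg M₂)
      have i4 := mul_le_mul_of_nonneg_left c4 hs0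
      have i4' := mul_le_mul_of_nonneg_right hs1 (abs_nonneg M₄)
      have j1 : 0 ≤ s * |M₁| := by positivity
      have j2 : 0 ≤ s * |M₂| := by positivity
      have i5 : 0 ≤ ε * (C + (P.gen f y - s / 2 * P.gen G y)) := by
        refine mul_nonneg hε.le ?_
        simp only [hC]
        linarith [abs_nonneg M₄]
      simp only [hK]
      linarith
  refine ⟨K, hK0, fun t ht x => le_of_forall_pos_sub_le fun η hη => ?_⟩
  refine h.le_hamiltonJacobi hf ht.1 ?_
  have hsmall : ∀ᶠ ε in 𝓝[>] (0 : ℝ), ε * C * t < η := by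
    have : Tendsto (fun ε : ℝ => ε * C * t) (𝓝 0) (𝓝 (0 * C * t)) :=
      Continuous.tendsto (by fun_prop) 0
    rw [zero_mul, zero_mul] at this
    exact (this.mono_left nhdsWithin_le_nhds).eventually (gt_mem_nhds hη)
  filter_upwards [hsmall, self_mem_nhdsWithin] with ε h1 h2
  have := hvis ε h2 t ht x
  linarith

/-- Hypercontractivity of the Hamilton-Jacobi semigroup for small times implies the local
logarithmic Sobolev inequality. -/
theorem IsDiffusion.localLogSobolev_of_hypercontractivity (h : P.IsDiffusion A) {u c : ℝ}
    (hu : 0 < u) (hc : 0 < c)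
    (hH : ∀ t, 0 < t → ∀ f ∈ A, ∀ x,
      (P.op u (fun y => Real.exp ((1 + t / (2 * c)) * P.hamiltonJacobi t f y)) x)
        ^ (1 / (1 + t / (2 * c))) ≤ P.op u (fun y => Real.exp (f y)) x) :
    P.LocalLogSobolev A u c := by
  intro f hf x
  have hM := P.isMarkov u hu.le
  obtain ⟨K, hK0, hK⟩ := h.exists_le_hamiltonJacobi hf
  set G := P.carreDuChamp f f with hG
  have hGA : G ∈ A := h.carreDuChamp_mem hf hf
  set g : E → ℝ := fun y => Real.exp (f y) with hg
  have hgA : g ∈ A := h.exp_comp_mem hf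
  obtain ⟨m, hm, hgm⟩ := h.exists_pos_le_exp hf
  set J := P.op u g x with hJ
  have hJ0 : 0 < J := hm.trans_le (h.le_op hgA hgm hu.le x)
  set l := Real.log J with hl
  set b : ℝ := 1 / (2 * c) with hb
  have hb0 : 0 < b := by positivity
  obtain ⟨B, hB⟩ := h.bounded f hf
  obtain ⟨B', hB'⟩ := h.bounded G hGA
  -- A lower bound for `Q_s f` on `[0, 1]`, differentiable in `s` with derivative `-G/2` at `0`.
  set w : ℝ → E → ℝ := fun s => f + (-s / 2) • G + fun _ => -K * s ^ 2 with hw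
  have hwA : ∀ s, w s ∈ A := fun s => A.add_mem (A.add_mem hf (A.smul_mem hGA _)) (const_mem A _)
  have hwx : ∀ s y, w s y = f y - s / 2 * G y - K * s ^ 2 := fun s y => by
    simp only [hw, Pi.add_apply, Pi.smul_apply, smul_eq_mul]; ring
  have hwle : ∀ s ∈ Icc (0 : ℝ) 1, ∀ y, w s y ≤ P.hamiltonJacobi s f y := fun s hs y => by
    rw [hwx]; exact hK s hs y
  have d1 : HasQuadDeriv w ((-1 / 2 : ℝ) • G) 1 0 := by
    refine ⟨K, hK0, fun r hr y => le_of_eq ?_⟩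
    have e : w r y - w 0 y - (r - 0) * ((-1 / 2 : ℝ) • G) y = -(K * r ^ 2) := by
      simp only [hwx, Pi.smul_apply, smul_eq_mul]; ring
    rw [e, abs_neg, abs_of_nonneg (by positivity), sub_zero, sq_abs]
  have h01 : (0 : ℝ) ∈ Icc (0 : ℝ) 1 := ⟨le_rfl, zero_le_one⟩
  have d2 := d1.affine_mul (h.bounded _ (A.smul_mem hGA _)) 1 b
  have e2 : (fun y => b * w 0 y + (1 + b * 0) * ((-1 / 2 : ℝ) • G) y)
      = b • f - (1 / 2 : ℝ) • G := by
    ext y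
    simp only [hwx, Pi.smul_apply, smul_eq_mul, Pi.sub_apply]; ring
  rw [e2] at d2
  have hDA := A.sub_mem (A.smul_mem hf b) (A.smul_mem hGA (1 / 2 : ℝ))
  have d3 := d2.exp (M := (1 + b) * B) h01 (h.bounded _ hDA) fun r hr y => by
    have c1 := (hwle r hr y).trans
      ((le_abs_self _).trans (h.abs_hamiltonJacobi_le hf hB hr.1 y))
    have c2 : 1 + b * r ≤ 1 + b := by linarith [mul_le_mul_of_nonneg_left hr.2 hb0.le]
    have c3 : 0 ≤ 1 + b * r := by have := hr.1; positivity
    exact (mul_le_mul_of_nonneg_left c1 c3).trans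
      (mul_le_mul_of_nonneg_right c2 ((abs_nonneg _).trans (hB y)))
  -- The right side raised to the power `1 + br` is `J^{1+br} = e^{(1+br)l}`, a scalar curve; a
  -- one-point space lets the same calculus treat it.
  have d4 : HasQuadDeriv (fun r (_ : Unit) => (1 + b * r) * l) (fun _ => b * l) 1 0 :=
    ⟨0, le_rfl, fun r hr y => by
      have : (1 + b * r) * l - (1 + b * 0) * l - (r - 0) * (b * l) = 0 := by ring
      rw [this, abs_zero, zero_mul]⟩
  have d5 := d4.exp (M := (1 + b) * |l|) h01 ⟨|b * l|, fun _ => le_rfl⟩ fun r hr y => by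
    refine (le_abs_self _).trans ?_
    rw [abs_mul, abs_of_nonneg (by have := hr.1; positivity)]
    refine mul_le_mul_of_nonneg_right ?_ (abs_nonneg l)
    linarith [mul_le_mul_of_nonneg_left hr.2 hb0.le]
  obtain ⟨C, hC0, hC⟩ := d3
  obtain ⟨C', hC'0, hC'⟩ := d5
  have hfg := A.mul_mem hf hgA
  have hgG := A.mul_mem hgA hGA
  have hgD := A.mul_mem hgA hDA
  have hD : P.op u (g * (b • f - (1 / 2 : ℝ) • G)) x
      = b * P.op u (f * g) x - 1 / 2 * P.op u (g * G) x := by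
    rw [← op_const_mul, ← op_const_mul]
    refine Eq.trans ?_ (h.op_sub (A.smul_mem hfg b) (A.smul_mem hgG (1 / 2 : ℝ)) hu.le x)
    congr 1
    ext y
    simp only [Pi.smul_apply, smul_eq_mul, Pi.mul_apply, Pi.sub_apply]
    ring
  -- Comparison of the derivatives at `t = 0`, where both sides equal `J`; multiplication by `2c =
  -- 1/b` turns it into the log Sobolev inequality.
  suffices hs : b * P.op u (f * g) x - 1 / 2 * P.op u (g * G) x - J * (b * l) ≤ 0 by
    have hbc : b * (2 * c) = 1 := by rw [hb]; field_simp
    have := mul_le_mul_of_nonneg_right hs (by positivity : 0 ≤ 2 * c)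
    change P.op u (f * g) x - J * l ≤ c * P.op u (g * G) x
    linear_combination this - (P.op u (f * g) x - J * l) * hbc
  rw [← hD]
  refine nonpos_of_forall_le_mul (d := 1) (K := C + C') one_pos fun t ht0 ht1 => ?_
  have htm : t ∈ Icc (0 : ℝ) 1 := ⟨ht0.le, ht1⟩
  have hq : 1 + t / (2 * c) = 1 + b * t := by rw [hb]; ring
  have hq0 : 0 < 1 + b * t := by positivity
  set F : E → ℝ := fun y => Real.exp ((1 + b * t) * w t y) with hF
  have hFA : F ∈ A := h.exp_comp_mem (A.smul_mem (hwA t) (1 + b * t))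
  have h1 : P.op u F x ≤ Real.exp ((1 + b * t) * l) := by
    have hHt := hH t ht0 f hf x
    rw [hq] at hHt
    set X := P.op u (fun y => Real.exp ((1 + b * t) * P.hamiltonJacobi t f y)) x
    have hX0 : 0 ≤ X := integral_nonneg fun y => (Real.exp_pos _).le
    have hFX : P.op u F x ≤ X := integral_mono (h.integrable hFA hu.le x)
      (h.integrable_exp_hamiltonJacobi hf ht0.le hu.le _ x) fun y =>
        Real.exp_le_exp.2 (mul_le_mul_of_nonneg_left (hwle t htm y) hq0.le)
    have := Real.rpow_le_rpow (Real.rpow_nonneg hX0 _) hHt hq0.le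
    rw [← Real.rpow_mul hX0, one_div, inv_mul_cancel₀ hq0.ne', Real.rpow_one] at this
    refine hFX.trans (this.trans (le_of_eq ?_))
    change J ^ (1 + b * t) = _
    rw [Real.rpow_def_of_pos hJ0, mul_comm]
  have h2 : |P.op u F x - J - t * P.op u (g * (b • f - (1 / 2 : ℝ) • G)) x| ≤ C * t ^ 2 := by
    have htD := A.smul_mem hgD t
    have e : P.op u (F - g - t • (g * (b • f - (1 / 2 : ℝ) • G))) x
        = P.op u F x - J - t * P.op u (g * (b • f - (1 / 2 : ℝ) • G)) x := by
      rw [h.op_sub (A.sub_mem hFA hgA) htD hu.le, h.op_sub hFA hgA hu.le, ← op_const_mul]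
      rfl
    rw [← e]
    refine abs_op_le hu.le (fun y => ?_) x
    have := hC t htm y
    simp only [hwx, mul_zero, add_zero, one_mul, zero_div, zero_mul, sub_zero, ne_eq,
      OfNat.ofNat_ne_zero, not_false_eq_true, zero_pow, sq_abs] at this
    simp only [Pi.sub_apply, Pi.mul_apply, Pi.smul_apply, smul_eq_mul, hF, hg, hwx] at this ⊢
    exact this
  have h3 := hC' t htm ()
  simp only [mul_zero, add_zero, one_mul, sub_zero, sq_abs] at h3
  rw [hl, Real.exp_log hJ0, ← hl] at h3
  have h4 := (abs_le.1 h2).1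
  have h5 := (abs_le.1 h3).2
  have : t * (P.op u (g * (b • f - (1 / 2 : ℝ) • G)) x - J * (b * l)) ≤ t * ((C + C') * t) := by
    linarith
  exact le_of_mul_le_mul_left this ht0

end HamiltonJacobi

end MarkovSemigroup

theorem mainTheorem4 {E : Type*} [MeasurableSpace E] (P : MarkovSemigroup E)
    (A : Subalgebra ℝ (E → ℝ)) (hP : P.IsDiffusion A) (ρ : ℝ) :
    P.CDInfty A ρ ↔
      ∀ q₁ q₂ u t : ℝ, 0 < q₂ → q₂ < q₁ → 0 < u → 0 < t →
        q₁ = q₂ + (if ρ = 0 then t / (2 * u) else ρ * t / (1 - Real.exp (-2 * ρ * u))) →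
        ∀ f ∈ A, ∀ x : E,
          (P.op u (fun y => Real.exp (q₁ * P.hamiltonJacobi t f y)) x) ^ (1 / q₁) ≤
            (P.op u (fun y => Real.exp (q₂ * f y)) x) ^ (1 / q₂) := by
  have hcc : ∀ u t : ℝ, 0 < u →
      (if ρ = 0 then t / (2 * u) else ρ * t / (1 - Real.exp (-2 * ρ * u)))
        = t / (2 * curvConst ρ u) := by
    intro u t hu
    have hc := curvConst_pos ρ hu
    unfold curvConst at hc ⊢
    split_ifs with h0
    · rfl
    · rw [if_neg h0] at hc
      have h1 : 1 - Real.exp (-2 * ρ * u) ≠ 0 := by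
        intro h1
        rw [h1, zero_div] at hc
        exact lt_irrefl _ hc
      field_simp
  constructor
  · intro hCD q₁ q₂ u t hq₂ _ hu ht hq₁ f hf x
    rw [hcc u t hu] at hq₁
    exact hP.hypercontractivity (fun u hu => hP.localLogSobolev_of_CDInfty hCD hu) hu ht hq₂ hq₁
      hf x
  · intro hH
    refine hP.CDInfty_of_localLogSobolev fun u hu => ?_
    have hc := curvConst_pos ρ hu
    refine hP.localLogSobolev_of_hypercontractivity hu hc fun t ht f hf x => ?_
    have hpos : 0 < t / (2 * curvConst ρ u) := by positivity
    -- The case `q₂ = 1` suffices for the converse.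
    have := hH (1 + t / (2 * curvConst ρ u)) 1 u t one_pos (by linarith) hu ht
      (by rw [hcc u t hu]) f hf x
    simpa using this
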